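/- Let $(A,\varphi)$ be a non-commutative $*$-probability space: $A$ is a complex unital $*$-algebra and $\varphi:A\to\mathbb C$ is linear with $\varphi(1)=1$ and $\varphi(a^*a)\ge 0$ for all $a\in A$. Let $(u_l,u_r)$ be a bi-Haar unitary pair in $A$: $u_l,u_r$ are unitaries, the algebras generated by $\{u_l,u_l^*\}$ and by $\{u_r,u_r^*\}$ commute, and for all $n,m\in\mathbb Z$, $\varphi(u_l^nu_r^m)=1$ if $n+m=0$ and $\varphi(u_l^nu_r^m)=0$ otherwise. For $n\ge 1$ and $\chi\in\{l,r\}^n$, let $s_\chi$ be the permutation of $\{1,\dots,n\}$ that lists first the elements of $\chi^{-1}(\{l\})$ in increasing order and then those of $\chi^{-1}(\{r\})$ in decreasing order; the $\chi$-order is $i\prec_\chi j\iff s_\chi^{-1}(i)<s_\chi^{-1}(j)$. Let $BNC(\chi)$ be the set, ordered by refinement, of partitions of $\{1,\dots,n\}$ in which no two distinct blocks cross in the $\chi$-order (i.e. $v_1\prec_\chi w_1\prec_\chi v_2\prec_\chi w_2$ with $v_1,v_2\in V$, $w_1,w_2\in W$ forces $V=W$), let $\mu$ be its Möbius function and $1_\chi$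 its maximal element. The bi-free cumulants are $$\kappa_\chi(a_1,\dots,a_n)=\sum_{\lambda\in BNC(\chi)}\mu(\lambda,1_\chi)\prod_{\{j_1<\dots<j_s\}\in\lambda}\varphi(a_{j_1}\cdots a_{j_s}).$$ A sequence with entries in $\{u_l,u_l^*,u_r,u_r^*\}$ is called alternating if of any two consecutive entries exactly one is a $*$-term ($u_l^*$ or $u_r^*$) and the other is a non-$*$-term ($u_l$ or $u_r$). Let $C_n$ be the $n$-th Catalan number. Then: 1. If $n\ge 1$, $\chi\in\{l,r\}^{2n}$ and $a_1,\dots,a_{2n}$ satisfy $a_i\in\{u_l,u_l^*\}$ when $\chi(i)=l$ and $a_i\in\{u_r,u_r^*\}$ when $\chi(i)=r$, and if $(a_{s_\chi(1)},\dots,a_{s_\chi(2n)})$ is alternating, then $$\kappa_\chi(a_1,\dots,a_{2n})=(-1)^{n-1}C_{n-1}.$$ 2. If $n\ge 1$, $\chi\in\{l,r\}^n$ and $a_1,\dots,a_n\in\{u_l,u_l^*,u_r,u_r^*\}$ are arbitrary, and if $n$ is odd or $(a_{s_\chi(1)},\dots,a_{s_\chi(n)})$ is not alternating, then $\kappa_\chi(a_1,\dots,a_n)=0$.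 3. The pair $(X,Y)=(u_l,u_r)$ is bi-R-diagonal, that is: for all $n\ge1$, $\chi\in\{l,r\}^n$ and $a_i\in\{X,X^*\}$ if $\chi(i)=l$, $a_i\in\{Y,Y^*\}$ if $\chi(i)=r$, one has $\kappa_\chi(a_1,\dots,a_n)=0$ whenever $n$ is odd, and also whenever $n$ is even and $(a_{s_\chi(1)},\dots,a_{s_\chi(n)})$ has none of the forms (a) $(Z,Z^*,\dots,Z,Z^*)$ with $Z\in\{X,X^*,Y,Y^*\}$; (b) $(X,X^*,\dots,X,X^*,Y,Y^*,\dots,Y,Y^*)$; (c) $(X^*,X,\dots,X^*,X,Y^*,Y,\dots,Y^*,Y)$; (d) $(X,X^*,\dots,X,X^*,X,Y^*,Y,\dots,Y^*,Y,Y^*)$; (e) $(X^*,X,\dots,X^*,X,X^*,Y,Y^*,\dots,Y,Y^*,Y)$, where the pairs may be repeated any number of times (including zero). -/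

import Mathlib

open scoped ComplexOrder

namespace BiFree

/-! ### Left-right labellings, the permutation `s_χ` and the `χ`-order -/

/-- The two labels: left and right. -/
inductive Side where
  | l
  | r
  deriving DecidableEq

/-- The indices labelled `l` in increasing order, followed by those labelled `r` in decreasing
order. -/
def chiList {n : ℕ} (χ : Fin n → Side) : List (Fin n) :=
  (List.finRange n).filter (fun i => χ i = Side.l) ++
    ((List.finRange n).filter (fun i => χ i = Side.r)).reverse

theorem mem_chiList {n : ℕ} (χ : Fin n → Side) (i : Fin n) : i ∈ chiList χ := by
  cases h : χ i <;> simp [chiList, h]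

theorem nodup_chiList {n : ℕ} (χ : Fin n → Side) : (chiList χ).Nodup := by
  refine List.Nodup.append ((List.nodup_finRange n).filter _)
    (List.nodup_reverse.2 ((List.nodup_finRange n).filter _)) ?_
  intro i hi hj
  simp only [List.mem_reverse, List.mem_filter, decide_eq_true_eq] at hi hj
  rw [hi.2] at hj
  exact absurd hj.2 (by decide)

theorem length_chiList {n : ℕ} (χ : Fin n → Side) : (chiList χ).length = n := by
  have h := Fintype.card_congr
    ((nodup_chiList χ).getEquivOfForallMemList (chiList χ) (mem_chiList χ))
  simpa using h

/-- The permutation `s_χ`: position `k` is sent to the `k`-th entry of `chiList χ`. -/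
def sPerm {n : ℕ} (χ : Fin n → Side) : Equiv.Perm (Fin n) :=
  (finCongr (length_chiList χ).symm).trans
    ((nodup_chiList χ).getEquivOfForallMemList (chiList χ) (mem_chiList χ))

/-- The (strict) `χ`-order on the indices. -/
def chiLT {n : ℕ} (χ : Fin n → Side) (i j : Fin n) : Prop :=
  (sPerm χ).symm i < (sPerm χ).symm j

/-! ### Bi-non-crossing partitions -/

/-- A partition is bi-non-crossing with respect to `χ` if no two distinct blocks cross in the
`χ`-order. -/
def IsBiNonCrossing {n : ℕ} (χ : Fin n → Side)
    (π : Finpartition (Finset.univ : Finset (Fin n))) : Prop :=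
  ∀ V ∈ π.parts, ∀ W ∈ π.parts, ∀ v₁ ∈ V, ∀ v₂ ∈ V, ∀ w₁ ∈ W, ∀ w₂ ∈ W,
    chiLT χ v₁ w₁ → chiLT χ w₁ v₂ → chiLT χ v₂ w₂ → V = W

/-- The set `BNC(χ)`, ordered by refinement. -/
abbrev BNC {n : ℕ} (χ : Fin n → Side) : Type :=
  {π : Finpartition (Finset.univ : Finset (Fin n)) // IsBiNonCrossing χ π}

noncomputable instance {n : ℕ} (χ : Fin n → Side) : Fintype (BNC χ) := Fintype.ofFinite _

open Classical in
noncomputable instance {n : ℕ} (χ : Fin n → Side) : LocallyFiniteOrder (BNC χ) :=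
  Fintype.toLocallyFiniteOrder

open Classical in
/-- The bi-non-crossing Möbius function: the Möbius function of the poset `BNC(χ)`. -/
noncomputable def muBNC {n : ℕ} (χ : Fin n → Side) (π σ : BNC χ) : ℂ :=
  IncidenceAlgebra.mu ℂ π σ

theorem isBiNonCrossing_top {n : ℕ} (χ : Fin n → Side) :
    IsBiNonCrossing χ (⊤ : Finpartition (Finset.univ : Finset (Fin n))) := by
  intro V hV W hW _ _ _ _ _ _ _ _ _ _ _
  have hV' := Finset.mem_singleton.1 (Finpartition.parts_top_subset _ hV)
  have hW' := Finset.mem_singleton.1 (Finpartition.parts_top_subset _ hW)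
  rw [hV', hW']

/-- The maximal element `1_χ` of `BNC(χ)`: the partition with one block. -/
def oneBNC {n : ℕ} (χ : Fin n → Side) : BNC χ := ⟨⊤, isBiNonCrossing_top χ⟩

section Cumulants

variable {A : Type*} [Ring A] [Algebra ℂ A]

/-- `φ((a_1, …, a_n)|_V) = φ(a_{j_1} ⋯ a_{j_s})` for `V = {j_1 < ⋯ < j_s}`. -/
def blockMoment (φ : A →ₗ[ℂ] ℂ) {n : ℕ} (a : Fin n → A) (V : Finset (Fin n)) : ℂ :=
  φ ((V.sort (· ≤ ·)).map a).prod

/-- `φ_π(a_1, …, a_n)`, the product of the block moments over the blocks of `π`. -/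
def partitionMoment (φ : A →ₗ[ℂ] ℂ) {n : ℕ}
    (π : Finpartition (Finset.univ : Finset (Fin n))) (a : Fin n → A) : ℂ :=
  ∏ V ∈ π.parts, blockMoment φ a V

open Classical in
/-- The bi-free cumulant function `κ_{χ,τ}`. -/
noncomputable def cumulantAt (φ : A →ₗ[ℂ] ℂ) {n : ℕ} (χ : Fin n → Side) (τ : BNC χ)
    (a : Fin n → A) : ℂ :=
  ∑ π : BNC χ with π ≤ τ, partitionMoment φ π.1 a * muBNC χ π τ

/-- The bi-free cumulant `κ_χ = κ_{χ,1_χ}`. -/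
noncomputable def cumulant (φ : A →ₗ[ℂ] ℂ) {n : ℕ} (χ : Fin n → Side) (a : Fin n → A) : ℂ :=
  cumulantAt φ χ (oneBNC χ) a

end Cumulants

section Pairs

variable {A : Type*} [Ring A] [StarRing A] [Algebra ℂ A]

/-- `(A, φ)` is a non-commutative `*`-probability space: `φ` is unital and positive. -/
structure IsStarState (φ : A →ₗ[ℂ] ℂ) : Prop where
  map_one : φ 1 = 1
  nonneg : ∀ a : A, 0 ≤ φ (star a * a)

/-- Entries of a word compatible with `χ`: in `{X, X*}` at the left indices and in `{Y, Y*}` at the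
right ones. -/
def Compatible {n : ℕ} (X Y : A) (χ : Fin n → Side) (a : Fin n → A) : Prop :=
  ∀ i, (χ i = Side.l → a i = X ∨ a i = star X) ∧ (χ i = Side.r → a i = Y ∨ a i = star Y)

/-- The word `Z, W, Z, W, …, Z, W` with `m` repetitions. -/
def repeatPair (m : ℕ) (Z W : A) : List A := (List.replicate m [Z, W]).flatten

/-- The five shapes of words allowed for a bi-R-diagonal pair. -/
def IsAllowedWord (X Y : A) (w : List A) : Prop :=
  (∃ m : ℕ, ∃ Z : A, (Z = X ∨ Z = star X ∨ Z = Y ∨ Z = star Y) ∧ w = repeatPair m Z (star Z)) ∨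
  (∃ p q : ℕ, w = repeatPair p X (star X) ++ repeatPair q Y (star Y)) ∨
  (∃ p q : ℕ, w = repeatPair p (star X) X ++ repeatPair q (star Y) Y) ∨
  (∃ p q : ℕ, w = repeatPair p X (star X) ++ [X] ++ repeatPair q (star Y) Y ++ [star Y]) ∨
  (∃ p q : ℕ, w = repeatPair p (star X) X ++ [star X] ++ repeatPair q Y (star Y) ++ [Y])

/-- The pair `(X, Y)` is bi-R-diagonal. -/
def IsBiRDiagonal (φ : A →ₗ[ℂ] ℂ) (X Y : A) : Prop :=
  ∀ n : ℕ, 1 ≤ n → ∀ (χ : Fin n → Side) (a : Fin n → A), Compatible X Y χ a →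
    (Odd n → cumulant φ χ a = 0) ∧
    (Even n → ¬ IsAllowedWord X Y (List.ofFn fun k => a (sPerm χ k)) → cumulant φ χ a = 0)

/-- A word is alternating in `*`-terms (`X*` or `Y*`) and non-`*`-terms (`X` or `Y`). -/
def IsStarAlternating (X Y : A) {n : ℕ} (w : Fin n → A) : Prop :=
  ∀ i j : Fin n, (i : ℕ) + 1 = j →
    ((w i = X ∨ w i = Y) ∧ (w j = star X ∨ w j = star Y)) ∨
    ((w i = star X ∨ w i = star Y) ∧ (w j = X ∨ w j = Y))

/-- The unitaries `u_l, u_r` form a bi-Haar unitary pair: the algebras generated by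
`{u_l, u_l*}` and `{u_r, u_r*}` commute, and `φ(u_l^n u_r^m)` is `1` if `n + m = 0` and `0`
otherwise, for all integers `n, m`. -/
structure IsBiHaarUnitaryPair (φ : A →ₗ[ℂ] ℂ) (u_l u_r : unitary A) : Prop where
  commute : ∀ x ∈ Algebra.adjoin ℂ {(u_l : A), star (u_l : A)},
    ∀ y ∈ Algebra.adjoin ℂ {(u_r : A), star (u_r : A)}, Commute x y
  moments : ∀ n m : ℤ,
    φ (((u_l ^ n : unitary A) : A) * ((u_r ^ m : unitary A) : A)) = if n + m = 0 then 1 else 0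

end Pairs

end BiFree

/-! Give `u_l`, `u_r` the sign `1` and their adjoints the sign `-1`. As the unitaries commute, a
product of entries is `u_l ^ p * u_r ^ q` with `p + q` the sum of the signs, so a block moment is
`1` if the signs of the block sum to zero and `0` otherwise (`IsBiHaarUnitaryPair.blockMoment_eq`).
The moments ignore sides and the order of the factors; `χ` enters only through the order that
forbids crossings, and the problem becomes that of the *-cumulants of a single Haar unitary.

By Möbius inversion (`cumulant_eq_of_moment_eq`) it suffices to guess the cumulants, `haarWeight`,
and to check that they reproduce the moments of all subsets (`ncSum_haarWeight`). Read the signs as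
a path with steps `±1`, and build the block of the first element from left to right. Passing from an
initial segment `P` of the block to its successor `j` cuts off the gap between them; by induction
the gap contributes `1` if its signs sum to zero and `0` otherwise. If the first sign is `1`, only
blocks whose partial sums stay in `{0, 1}` have nonzero weight, so `j` must be a step of the path
between the heights `0` and `1`. When the total is zero, the sum over all completions of `P` thus
depends only on the size of `P` and the number `x` of such steps left. The numbers `ballot P.card x`
solve the resulting recursion, and `ballot 1 x = 1` is the required moment.

For bi-R-diagonality, an alternating word of even length in which the left entries come first splits
into two alternating words of equal parity, which gives the shapes (b) to (e); shape (a) is the case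
where one of the two is empty. -/

namespace BiFree

/-! ### Non-crossing partitions of arbitrary finite subsets, and weighted sums over them -/

section NonCrossing

variable {α : Type*} [DecidableEq α]

/-- `F` is the family of blocks of a partition of `s` which is non-crossing for the order induced
by `pos`. -/
structure IsNC (pos : α → ℕ) (s : Finset α) (F : Finset (Finset α)) : Prop where
  nonempty : ∀ V ∈ F, V.Nonempty
  eq_of_mem : ∀ V ∈ F, ∀ W ∈ F, ∀ x, x ∈ V → x ∈ W → V = W
  mem_iff : ∀ x, x ∈ s ↔ ∃ V ∈ F, x ∈ V
  noncrossing : ∀ V ∈ F, ∀ W ∈ F, ∀ v₁ ∈ V, ∀ v₂ ∈ V, ∀ w₁ ∈ W, ∀ w₂ ∈ W,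
    pos v₁ < pos w₁ → pos w₁ < pos v₂ → pos v₂ < pos w₂ → V = W

open Classical in
/-- The non-crossing partitions of `s` which satisfy `p`. -/
noncomputable def ncFamilies (pos : α → ℕ) (s : Finset α) (p : Finset (Finset α) → Prop) :
    Finset (Finset (Finset α)) :=
  s.powerset.powerset.filter fun F => IsNC pos s F ∧ p F

/-- The sum over the non-crossing partitions of `s` satisfying `p` of the product of the weights of
the blocks. -/
noncomputable def ncSum (pos : α → ℕ) (g : Finset α → ℂ) (s : Finset α)
    (p : Finset (Finset α) → Prop) : ℂ :=
  ∑ F ∈ ncFamilies pos s p, ∏ V ∈ F, g V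

variable {pos : α → ℕ} {g : Finset α → ℂ} {s t : Finset α} {F G : Finset (Finset α)}

omit [DecidableEq α] in
theorem IsNC.subset (h : IsNC pos s F) {V : Finset α} (hV : V ∈ F) : V ⊆ s :=
  fun x hx => (h.mem_iff x).2 ⟨V, hV, hx⟩

omit [DecidableEq α] in
theorem mem_ncFamilies {p : Finset (Finset α) → Prop} :
    F ∈ ncFamilies pos s p ↔ IsNC pos s F ∧ p F := by
  simp only [ncFamilies, Finset.mem_filter, Finset.mem_powerset, and_iff_right_iff_imp]
  intro h V hV
  exact Finset.mem_powerset.2 (h.1.subset hV)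

theorem IsNC.filter_subset (h : IsNC pos (s ∪ t) F) (hst : Disjoint s t)
    (hF : ∀ V ∈ F, V ⊆ s ∨ V ⊆ t) : IsNC pos s (F.filter (· ⊆ s)) where
  nonempty V hV := h.nonempty V (Finset.mem_filter.1 hV).1
  eq_of_mem V hV W hW := h.eq_of_mem V (Finset.mem_filter.1 hV).1 W (Finset.mem_filter.1 hW).1
  mem_iff x := by
    constructor
    · intro hx
      obtain ⟨V, hV, hxV⟩ := (h.mem_iff x).1 (Finset.mem_union_left _ hx)
      refine ⟨V, Finset.mem_filter.2 ⟨hV, (hF V hV).resolve_right fun hVt => ?_⟩, hxV⟩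
      exact Finset.disjoint_left.1 hst hx (hVt hxV)
    · rintro ⟨V, hV, hxV⟩
      exact (Finset.mem_filter.1 hV).2 hxV
  noncrossing V hV W hW :=
    h.noncrossing V (Finset.mem_filter.1 hV).1 W (Finset.mem_filter.1 hW).1

theorem IsNC.union (hF : IsNC pos s F) (hG : IsNC pos t G) (hst : Disjoint s t)
    (hFG : ∀ V ∈ F, ∀ W ∈ G, ∀ v₁ ∈ V, ∀ v₂ ∈ V, ∀ w₁ ∈ W, ∀ w₂ ∈ W,
      pos v₁ < pos w₁ → pos w₁ < pos v₂ → pos v₂ < pos w₂ → False)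
    (hGF : ∀ V ∈ F, ∀ W ∈ G, ∀ v₁ ∈ V, ∀ v₂ ∈ V, ∀ w₁ ∈ W, ∀ w₂ ∈ W,
      pos w₁ < pos v₁ → pos v₁ < pos w₂ → pos w₂ < pos v₂ → False) :
    IsNC pos (s ∪ t) (F ∪ G) where
  nonempty V hV := (Finset.mem_union.1 hV).elim (hF.nonempty V) (hG.nonempty V)
  eq_of_mem V hV W hW x hxV hxW := by
    have := @Finset.disjoint_left _ s t
    rcases Finset.mem_union.1 hV with hV | hV <;> rcases Finset.mem_union.1 hW with hW | hW
    · exact hF.eq_of_mem V hV W hW x hxV hxW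
    · exact absurd (hG.subset hW hxW) (this.1 hst (hF.subset hV hxV))
    · exact absurd (hG.subset hV hxV) (this.1 hst (hF.subset hW hxW))
    · exact hG.eq_of_mem V hV W hW x hxV hxW
  mem_iff x := by
    rw [Finset.mem_union, hF.mem_iff, hG.mem_iff]
    simp only [Finset.mem_union]
    grind
  noncrossing V hV W hW v₁ hv₁ v₂ hv₂ w₁ hw₁ w₂ hw₂ h₁ h₂ h₃ := by
    rcases Finset.mem_union.1 hV with hV | hV <;> rcases Finset.mem_union.1 hW with hW | hW
    · exact hF.noncrossing V hV W hW v₁ hv₁ v₂ hv₂ w₁ hw₁ w₂ hw₂ h₁ h₂ h₃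
    · exact (hFG V hV W hW v₁ hv₁ v₂ hv₂ w₁ hw₁ w₂ hw₂ h₁ h₂ h₃).elim
    · exact (hGF W hW V hV w₁ hw₁ w₂ hw₂ v₁ hv₁ v₂ hv₂ h₁ h₂ h₃).elim
    · exact hG.noncrossing V hV W hW v₁ hv₁ v₂ hv₂ w₁ hw₁ w₂ hw₂ h₁ h₂ h₃

theorem IsNC.filter_union_left (hF : IsNC pos s F) (hG : IsNC pos t G) (hst : Disjoint s t) :
    (F ∪ G).filter (· ⊆ s) = F := by
  ext V
  simp only [Finset.mem_filter, Finset.mem_union]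
  constructor
  · rintro ⟨hV | hV, hVs⟩
    · exact hV
    · obtain ⟨x, hx⟩ := hG.nonempty V hV
      exact absurd (hG.subset hV hx) (Finset.disjoint_left.1 hst (hVs hx))
  · exact fun hV => ⟨Or.inl hV, hF.subset hV⟩

/-- Non-crossing partitions that split along `s` and `t` correspond to pairs of non-crossing
partitions of `s` and of `t`. -/
theorem ncSum_union (hst : Disjoint s t) {p q r : Finset (Finset α) → Prop}
    (hr : ∀ F, IsNC pos (s ∪ t) F → r F → (∀ V ∈ F, V ⊆ s ∨ V ⊆ t) ∧
      p (F.filter (· ⊆ s)) ∧ q (F.filter (· ⊆ t)))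
    (hpq : ∀ F G, IsNC pos s F → p F → IsNC pos t G → q G →
      IsNC pos (s ∪ t) (F ∪ G) ∧ r (F ∪ G)) :
    ncSum pos g (s ∪ t) r = ncSum pos g s p * ncSum pos g t q := by
  rw [ncSum, ncSum, ncSum, Finset.sum_mul_sum, ← Finset.sum_product']
  refine Finset.sum_bij' (fun F _ => (F.filter (· ⊆ s), F.filter (· ⊆ t)))
    (fun x _ => x.1 ∪ x.2) ?_ ?_ ?_ ?_ ?_
  · intro F hF
    obtain ⟨hF, hrF⟩ := mem_ncFamilies.1 hF
    obtain ⟨h, hp, hq⟩ := hr F hF hrF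
    refine Finset.mem_product.2 ⟨mem_ncFamilies.2 ⟨hF.filter_subset hst h, hp⟩,
      mem_ncFamilies.2 ⟨?_, hq⟩⟩
    rw [Finset.union_comm] at hF
    exact hF.filter_subset hst.symm fun V hV => (h V hV).symm
  · rintro ⟨F, G⟩ hx
    obtain ⟨hF, hG⟩ := Finset.mem_product.1 hx
    obtain ⟨hF, hpF⟩ := mem_ncFamilies.1 hF
    obtain ⟨hG, hqG⟩ := mem_ncFamilies.1 hG
    exact mem_ncFamilies.2 (hpq F G hF hpF hG hqG)
  · intro F hF
    obtain ⟨hF, hrF⟩ := mem_ncFamilies.1 hF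
    have h := (hr F hF hrF).1
    rw [← Finset.filter_or]
    exact Finset.filter_true_of_mem h
  · rintro ⟨F, G⟩ hx
    obtain ⟨hF, hG⟩ := Finset.mem_product.1 hx
    have hF := (mem_ncFamilies.1 hF).1
    have hG := (mem_ncFamilies.1 hG).1
    refine Prod.ext (hF.filter_union_left hG hst) ?_
    change (F ∪ G).filter (· ⊆ t) = G
    rw [Finset.union_comm]
    exact hG.filter_union_left hF hst.symm
  · intro F hF
    obtain ⟨hF, hrF⟩ := mem_ncFamilies.1 hF
    have h := (hr F hF hrF).1
    rw [← Finset.prod_union, ← Finset.filter_or, Finset.filter_true_of_mem h]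
    refine Finset.disjoint_left.2 fun V hV hV' => ?_
    obtain ⟨hVF, hVs⟩ := Finset.mem_filter.1 hV
    obtain ⟨x, hx⟩ := hF.nonempty V hVF
    exact Finset.disjoint_left.1 hst (hVs hx) ((Finset.mem_filter.1 hV').2 hx)

omit [DecidableEq α] in
theorem isNC_empty_iff : IsNC pos ∅ F ↔ F = ∅ := by
  constructor
  · intro h
    refine Finset.eq_empty_of_forall_notMem fun V hV => ?_
    obtain ⟨x, hx⟩ := h.nonempty V hV
    exact absurd (h.subset hV hx) (Finset.notMem_empty x)
  · rintro rfl
    constructor <;> simp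

omit [DecidableEq α] in
theorem ncSum_empty {p : Finset (Finset α) → Prop} (hp : p ∅) : ncSum pos g ∅ p = 1 := by
  have : ncFamilies pos ∅ p = {∅} := by
    ext F
    rw [mem_ncFamilies, isNC_empty_iff, Finset.mem_singleton]
    grind
  rw [ncSum, this]
  simp

omit [DecidableEq α] in
theorem isNC_singleton (hs : s.Nonempty) : IsNC pos s {s} := by
  constructor <;> simp [hs]

omit [DecidableEq α] in
theorem ncSum_mem_self (hs : s.Nonempty) : ncSum pos g s (s ∈ ·) = g s := by
  have : ncFamilies pos s (s ∈ ·) = {{s}} := by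
    ext F
    rw [mem_ncFamilies, Finset.mem_singleton]
    constructor
    · rintro ⟨h, hF⟩
      refine Finset.eq_singleton_iff_unique_mem.2 ⟨hF, fun V hV => ?_⟩
      obtain ⟨x, hx⟩ := h.nonempty V hV
      exact h.eq_of_mem V hV s hF x hx (h.subset hV hx)
    · rintro rfl
      exact ⟨isNC_singleton hs, Finset.mem_singleton_self s⟩
  rw [ncSum, this]
  simp

omit [DecidableEq α] in
theorem ncSum_congr {p q : Finset (Finset α) → Prop}
    (h : ∀ F, IsNC pos s F → (p F ↔ q F)) : ncSum pos g s p = ncSum pos g s q := by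
  have : ncFamilies pos s p = ncFamilies pos s q := by
    ext F
    rw [mem_ncFamilies, mem_ncFamilies]
    exact and_congr_right (h F)
  rw [ncSum, ncSum, this]

/-- The sum over refinements of a non-crossing partition is multiplicative over its blocks. -/
theorem ncSum_refine {S : Finset (Finset α)} (hS : IsNC pos s S) :
    ncSum pos g s (fun F => ∀ V ∈ F, ∃ U ∈ S, V ⊆ U) =
      ∏ U ∈ S, ncSum pos g U fun _ => True := by
  -- The blocks of `S` are split off one at a time, so the claim has to cover every subfamily
  -- together with its union.
  have key : ∀ T : Finset (Finset α), T ⊆ S →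
      ncSum pos g (T.biUnion id) (fun F => ∀ V ∈ F, ∃ U ∈ T, V ⊆ U) =
        ∏ U ∈ T, ncSum pos g U fun _ => True := by
    intro T
    induction T using Finset.induction_on with
    | empty => intro _; simpa using ncSum_empty (pos := pos) (g := g) (by simp)
    | insert U T hU ih =>
      intro hT
      have hUS : U ∈ S := hT (Finset.mem_insert_self U T)
      have hTS : ∀ W ∈ T, W ∈ S := fun W hW => hT (Finset.mem_insert_of_mem hW)
      rw [Finset.prod_insert hU, ← ih hTS, Finset.biUnion_insert, id]
      have hdisj : Disjoint U (T.biUnion id) := by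
        refine Finset.disjoint_left.2 fun x hx hx' => ?_
        obtain ⟨W, hW, hxW⟩ := Finset.mem_biUnion.1 hx'
        exact hU (hS.eq_of_mem U hUS W (hTS W hW) x hx hxW ▸ hW)
      refine ncSum_union hdisj ?_ ?_
      · intro F hF hr
        refine ⟨fun V hV => ?_, trivial, fun V hV => ?_⟩
        · obtain ⟨W, hW, hVW⟩ := hr V hV
          rcases Finset.mem_insert.1 hW with rfl | hW
          · exact Or.inl hVW
          · exact Or.inr (hVW.trans (Finset.subset_biUnion_of_mem id hW))
        · obtain ⟨hV, hVT⟩ := Finset.mem_filter.1 hV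
          obtain ⟨W, hW, hVW⟩ := hr V hV
          rcases Finset.mem_insert.1 hW with rfl | hW
          · obtain ⟨x, hx⟩ := hF.nonempty V hV
            exact absurd (hVT hx) (Finset.disjoint_left.1 hdisj (hVW hx))
          · exact ⟨W, hW, hVW⟩
      · intro F G hF _ hG hq
        have hne : ∀ W ∈ T, U ≠ W := fun W hW h => hU (h ▸ hW)
        refine ⟨hF.union hG hdisj ?_ ?_, fun V hV => ?_⟩
        · intro V hV W hW v₁ hv₁ v₂ hv₂ w₁ hw₁ w₂ hw₂ h₁ h₂ h₃
          obtain ⟨W', hW', hWW'⟩ := hq W hW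
          exact hne W' hW' (hS.noncrossing U hUS W' (hTS W' hW') v₁ (hF.subset hV hv₁) v₂
            (hF.subset hV hv₂) w₁ (hWW' hw₁) w₂ (hWW' hw₂) h₁ h₂ h₃)
        · intro V hV W hW v₁ hv₁ v₂ hv₂ w₁ hw₁ w₂ hw₂ h₁ h₂ h₃
          obtain ⟨W', hW', hWW'⟩ := hq W hW
          exact hne W' hW' (hS.noncrossing W' (hTS W' hW') U hUS w₁ (hWW' hw₁) w₂ (hWW' hw₂) v₁
            (hF.subset hV hv₁) v₂ (hF.subset hV hv₂) h₁ h₂ h₃).symm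
        · rcases Finset.mem_union.1 hV with hV | hV
          · exact ⟨U, Finset.mem_insert_self U T, hF.subset hV⟩
          · obtain ⟨W, hW, hVW⟩ := hq V hV
            exact ⟨W, Finset.mem_insert_of_mem hW, hVW⟩
  have hs : S.biUnion id = s := by
    ext x
    rw [hS.mem_iff x, Finset.mem_biUnion]
    rfl
  rw [← key S subset_rfl, hs]

end NonCrossing

/-! ### Building one block from left to right -/

section OpenBlock

variable {α : Type*} [DecidableEq α] {pos : α → ℕ} {g : Finset α → ℂ} {P s : Finset α}

/-- The block containing `P` either ends there or has a first further element `j`. The condition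
`pos j ≤ pos i` pins down `j` as that successor and makes the cases disjoint. -/
theorem ncSum_open_split (hpos : pos.Injective) (hP : P.Nonempty)
    (hlt : ∀ x ∈ P, ∀ y ∈ s, pos x < pos y) :
    ncSum pos g (P ∪ s) (fun F => ∃ B ∈ F, P ⊆ B) =
      ncSum pos g (P ∪ s) (P ∈ ·) +
        ∑ j ∈ s, ncSum pos g (P ∪ s)
          (fun F => ∃ B ∈ F, insert j P ⊆ B ∧ ∀ i ∈ B, i ∈ P ∨ pos j ≤ pos i) := by
  obtain ⟨x, hx⟩ := hP
  have hxs : ∀ j ∈ s, j ∉ P := fun j hj hjP => lt_irrefl _ (hlt j hjP j hj)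
  have hunion : ncFamilies pos (P ∪ s) (fun F => ∃ B ∈ F, P ⊆ B) =
      ncFamilies pos (P ∪ s) (P ∈ ·) ∪ s.biUnion fun j => ncFamilies pos (P ∪ s)
        (fun F => ∃ B ∈ F, insert j P ⊆ B ∧ ∀ i ∈ B, i ∈ P ∨ pos j ≤ pos i) := by
    ext F
    simp only [Finset.mem_union, Finset.mem_biUnion, mem_ncFamilies]
    constructor
    · rintro ⟨hF, B, hB, hPB⟩
      rcases (B \ P).eq_empty_or_nonempty with h | h
      · have : B = P := Finset.Subset.antisymm (Finset.sdiff_eq_empty_iff_subset.1 h) hPB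
        exact Or.inl ⟨hF, this ▸ hB⟩
      · obtain ⟨j, hj, hmin⟩ := Finset.exists_min_image (B \ P) pos h
        obtain ⟨hjB, hjP⟩ := Finset.mem_sdiff.1 hj
        refine Or.inr ⟨j, ?_, hF, B, hB, Finset.insert_subset hjB hPB, fun i hi => ?_⟩
        · exact (Finset.mem_union.1 (hF.subset hB hjB)).resolve_left hjP
        · by_cases hiP : i ∈ P
          · exact Or.inl hiP
          · exact Or.inr (hmin i (Finset.mem_sdiff.2 ⟨hi, hiP⟩))
    · rintro (⟨hF, hP⟩ | ⟨j, _, hF, B, hB, hjB, _⟩)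
      · exact ⟨hF, P, hP, subset_rfl⟩
      · exact ⟨hF, B, hB, (Finset.subset_insert j P).trans hjB⟩
  rw [ncSum, hunion, Finset.sum_union, Finset.sum_biUnion]
  · rfl
  · intro j hj k hk hjk
    refine Finset.disjoint_left.2 fun F h₁ h₂ => hjk (hpos ?_)
    obtain ⟨hF, B, hB, hjB, hB'⟩ := mem_ncFamilies.1 h₁
    obtain ⟨-, C, hC, hkC, hC'⟩ := mem_ncFamilies.1 h₂
    obtain rfl : B = C := hF.eq_of_mem B hB C hC x (hjB (Finset.mem_insert_of_mem hx))
      (hkC (Finset.mem_insert_of_mem hx))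
    exact le_antisymm ((hB' k (hkC (Finset.mem_insert_self k P))).resolve_left (hxs k hk))
      ((hC' j (hjB (Finset.mem_insert_self j P))).resolve_left (hxs j hj))
  · refine Finset.disjoint_left.2 fun F h₁ h₂ => ?_
    obtain ⟨hF, hPF⟩ := mem_ncFamilies.1 h₁
    obtain ⟨j, hj, h₂⟩ := Finset.mem_biUnion.1 h₂
    obtain ⟨-, B, hB, hjB, -⟩ := mem_ncFamilies.1 h₂
    obtain rfl : B = P := hF.eq_of_mem B hB P hPF x (hjB (Finset.mem_insert_of_mem hx)) hx
    exact hxs j hj (hjB (Finset.mem_insert_self j B))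

theorem ncSum_closed (hP : P.Nonempty) (hlt : ∀ x ∈ P, ∀ y ∈ s, pos x < pos y) :
    ncSum pos g (P ∪ s) (P ∈ ·) = g P * ncSum pos g s fun _ => True := by
  have hdisj : Disjoint P s :=
    Finset.disjoint_left.2 fun j hjP hj => lt_irrefl _ (hlt j hjP j hj)
  rw [← ncSum_mem_self (pos := pos) (g := g) hP]
  refine ncSum_union hdisj ?_ ?_
  · intro F hF hPF
    refine ⟨fun V hV => ?_, Finset.mem_filter.2 ⟨hPF, subset_rfl⟩, trivial⟩
    by_cases h : V = P
    · exact Or.inl h.subset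
    · refine Or.inr fun x hx => (Finset.mem_union.1 (hF.subset hV hx)).resolve_left fun hxP => ?_
      exact h (hF.eq_of_mem V hV P hPF x hx hxP)
  · intro F G hF hPF hG _
    refine ⟨hF.union hG hdisj ?_ ?_, Finset.mem_union_left _ hPF⟩
    · intro V hV W hW v₁ hv₁ v₂ hv₂ w₁ hw₁ w₂ hw₂ h₁ h₂ h₃
      exact h₂.asymm (hlt v₂ (hF.subset hV hv₂) w₁ (hG.subset hW hw₁))
    · intro V hV W hW v₁ hv₁ v₂ hv₂ w₁ hw₁ w₂ hw₂ h₁ h₂ h₃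
      exact h₁.asymm (hlt v₁ (hF.subset hV hv₁) w₁ (hG.subset hW hw₁))

/-- Once `j` is known to follow `P` in its block, no other block can join the gap before `j` to the
elements after `j`, so the gap and the rest are partitioned independently. -/
theorem ncSum_next (hpos : pos.Injective) (hP : P.Nonempty)
    (hlt : ∀ x ∈ P, ∀ y ∈ s, pos x < pos y) {j : α} (hj : j ∈ s) :
    ncSum pos g (P ∪ s)
        (fun F => ∃ B ∈ F, insert j P ⊆ B ∧ ∀ i ∈ B, i ∈ P ∨ pos j ≤ pos i) =
      ncSum pos g {i ∈ s | pos i < pos j} (fun _ => True) *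
        ncSum pos g (insert j P ∪ {i ∈ s | pos j < pos i}) fun F => ∃ B ∈ F, insert j P ⊆ B := by
  obtain ⟨x, hx⟩ := hP
  have hset : P ∪ s = {i ∈ s | pos i < pos j} ∪ (insert j P ∪ {i ∈ s | pos j < pos i}) := by
    ext i
    have := @hpos i j
    simp only [Finset.mem_union, Finset.mem_filter, Finset.mem_insert]
    grind
  have hdisj : Disjoint {i ∈ s | pos i < pos j} (insert j P ∪ {i ∈ s | pos j < pos i}) := by
    refine Finset.disjoint_left.2 fun i hi hi' => ?_
    have := hlt i
    simp only [Finset.mem_union, Finset.mem_filter, Finset.mem_insert] at hi hi'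
    grind
  have hlow : ∀ i, i ∈ insert j P ∪ {i ∈ s | pos j < pos i} → pos i < pos j → i ∈ P := by
    intro i hi hij
    simp only [Finset.mem_union, Finset.mem_filter, Finset.mem_insert] at hi
    grind
  rw [hset]
  refine ncSum_union hdisj ?_ ?_
  · rintro F hF ⟨B, hB, hjB, hmin⟩
    have hBs : B ⊆ insert j P ∪ {i ∈ s | pos j < pos i} := by
      intro i hi
      have h₁ := hF.subset hB hi
      have h₂ := hmin i hi
      simp only [Finset.mem_union, Finset.mem_filter, Finset.mem_insert] at h₁ ⊢
      grind
    refine ⟨fun V hV => ?_, trivial, B, Finset.mem_filter.2 ⟨hB, hBs⟩, hjB⟩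
    by_cases hVB : V = B
    · exact Or.inr (hVB ▸ hBs)
    -- Otherwise `V` has an element `v` in the gap and an element `w` beyond `j`, and `x < v < j <
    -- w` is a crossing with `B`, where `x ∈ P`.
    by_contra! hcon
    obtain ⟨w, hw, hw'⟩ := Finset.not_subset.1 hcon.1
    obtain ⟨v, hv, hv'⟩ := Finset.not_subset.1 hcon.2
    have hvs := (Finset.mem_union.1 (hF.subset hV hv)).resolve_right hv'
    have hws := (Finset.mem_union.1 (hF.subset hV hw)).resolve_left hw'
    have hwj : w ∉ insert j P := fun h => hVB (hF.eq_of_mem V hV B hB w hw (hjB h))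
    have hwj := (Finset.mem_filter.1 ((Finset.mem_union.1 hws).resolve_left hwj)).2
    obtain ⟨hvs, hvj⟩ := Finset.mem_filter.1 hvs
    exact hVB (hF.noncrossing B hB V hV x (hjB (Finset.mem_insert_of_mem hx)) j
      (hjB (Finset.mem_insert_self j P)) v hv w hw (hlt x hx v hvs) hvj hwj).symm
  · rintro F G hF - hG ⟨B, hB, hjB⟩
    refine ⟨hF.union hG hdisj ?_ ?_, B, Finset.mem_union_right _ hB, hjB, fun i hi => ?_⟩
    · intro V hV W hW v₁ hv₁ v₂ hv₂ w₁ hw₁ w₂ hw₂ h₁ h₂ h₃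
      have hv₁ := (Finset.mem_filter.1 (hF.subset hV hv₁))
      have hv₂ := (Finset.mem_filter.1 (hF.subset hV hv₂))
      exact h₁.asymm (hlt w₁ (hlow w₁ (hG.subset hW hw₁) (h₂.trans hv₂.2)) v₁ hv₁.1)
    · intro V hV W hW v₁ hv₁ v₂ hv₂ w₁ hw₁ w₂ hw₂ h₁ h₂ h₃
      have hv₁ := (Finset.mem_filter.1 (hF.subset hV hv₁))
      have hv₂ := (Finset.mem_filter.1 (hF.subset hV hv₂))
      exact h₂.asymm (hlt w₂ (hlow w₂ (hG.subset hW hw₂) (h₃.trans hv₂.2)) v₁ hv₁.1)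
    · have h := hG.subset hB hi
      simp only [Finset.mem_union, Finset.mem_filter, Finset.mem_insert] at h
      grind

/-- Expansion according to the successor, in its block, of an initial segment `P` of the block. -/
theorem ncSum_open (hpos : pos.Injective) (hP : P.Nonempty)
    (hlt : ∀ x ∈ P, ∀ y ∈ s, pos x < pos y) :
    ncSum pos g (P ∪ s) (fun F => ∃ B ∈ F, P ⊆ B) =
      g P * ncSum pos g s (fun _ => True) +
        ∑ j ∈ s, ncSum pos g {i ∈ s | pos i < pos j} (fun _ => True) *
          ncSum pos g (insert j P ∪ {i ∈ s | pos j < pos i})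
            fun F => ∃ B ∈ F, insert j P ⊆ B := by
  rw [ncSum_open_split hpos hP hlt, ncSum_closed hP hlt]
  exact congrArg _ (Finset.sum_congr rfl fun j hj => ncSum_next hpos hP hlt hj)

end OpenBlock

/-! ### Solution of the recursion for completions of a block -/

section BallotNumbers

/-- Signed ballot numbers. -/
def ballot : ℕ → ℕ → ℤ
  | 0, _ => 0
  | 1, _ => 1
  | q + 2, x => (-1) ^ ((q + x) / 2) * (q.choose ((q + x) / 2) - q.choose ((q + x) / 2 + 1))

theorem catalan_eq_choose_sub_choose (M : ℕ) :
    (catalan M : ℤ) = (2 * M).choose M - (2 * M).choose (M + 1) := by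
  have h₁ := succ_mul_catalan_eq_centralBinom M
  have h₂ := Nat.choose_succ_right_eq (2 * M) M
  rw [Nat.centralBinom_eq_two_mul_choose] at h₁
  rw [two_mul, Nat.add_sub_cancel, ← two_mul] at h₂
  have h₃ : ((M : ℤ) + 1) ≠ 0 := by positivity
  refine mul_left_cancel₀ h₃ ?_
  zify at h₁ h₂
  linear_combination h₁ + h₂

theorem ballot_zero_right (M : ℕ) : ballot (2 * M + 2) 0 = (-1) ^ M * (catalan M : ℤ) := by
  have h : (2 * M + 0) / 2 = M := by omega
  rw [ballot, h, catalan_eq_choose_sub_choose]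

theorem ballot_one_right (r : ℕ) : ballot (2 * r + 1) 1 = ballot (2 * r + 2) 0 := by
  cases r with
  | zero => simp [ballot]
  | succ r =>
    have h₁ : 2 * (r + 1) + 1 = (2 * r + 1) + 2 := by ring
    have h₂ : (2 * r + 1 + 1) / 2 = r + 1 := by omega
    have h₃ : (2 * (r + 1) + 0) / 2 = r + 1 := by omega
    rw [h₁, ballot, ballot, h₂, h₃]
    have h₄ := Nat.choose_symm_half r
    have h₅ := Nat.choose_succ_succ' (2 * r + 1) r
    have h₆ := Nat.choose_succ_succ' (2 * r + 1) (r + 1)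
    have h₇ : 2 * (r + 1) = 2 * r + 1 + 1 := by ring
    rw [h₇, h₅, h₆]
    push_cast
    rw [← h₄]
    ring

/-- This is Pascal's rule; for `p = 1` the last term vanishes because its binomial coefficients are
`0.choose` of positive numbers. -/
theorem ballot_add_two {p x : ℕ} (hp : 1 ≤ p) (hx : x % 2 = p % 2) :
    ballot p (x + 2) = ballot p x + ballot (p + 1) (x + 1) := by
  obtain ⟨p, rfl⟩ := Nat.exists_eq_add_of_le hp
  cases p with
  | zero =>
    obtain ⟨t, ht⟩ : ∃ t, (x + 1) / 2 = t + 1 := ⟨(x + 1) / 2 - 1, by omega⟩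
    simp [ballot, ht]
  | succ q =>
    obtain ⟨t, ht⟩ : ∃ t, q + x = 2 * t := ⟨(q + x) / 2, by omega⟩
    have e₁ : (q + (x + 2)) / 2 = t + 1 := by omega
    have e₂ : (q + x) / 2 = t := by omega
    have e₃ : (q + 1 + (x + 1)) / 2 = t + 1 := by omega
    have e₄ : 1 + (q + 1) = q + 2 := by ring
    have e₅ : q + 2 + 1 = (q + 1) + 2 := by ring
    rw [e₄, e₅, ballot, ballot, ballot, e₁, e₂, e₃, Nat.choose_succ_succ' q t,
      Nat.choose_succ_succ' q (t + 1)]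
    push_cast
    ring

/-- With `p` elements chosen and `x` crossings left, the first term closes the block, which needs
`p` even, and the sum runs over the next element, `y` being the number of crossings left after it.
-/
theorem ballot_eq_add_sum {p x : ℕ} (hp : 1 ≤ p) (hx : x % 2 = p % 2) :
    ballot p x = (if p % 2 = 0 then (-1) ^ (p / 2 - 1) * (catalan (p / 2 - 1) : ℤ) else 0) +
      ∑ y ∈ Finset.range x with y % 2 = (p + 1) % 2, ballot (p + 1) y := by
  have step : ∀ x, x % 2 = p % 2 →
      ∑ y ∈ Finset.range (x + 2) with y % 2 = (p + 1) % 2, ballot (p + 1) y =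
        (∑ y ∈ Finset.range x with y % 2 = (p + 1) % 2, ballot (p + 1) y) +
          ballot (p + 1) (x + 1) := by
    intro x hx
    rw [Finset.sum_filter, Finset.sum_filter, Finset.sum_range_succ, Finset.sum_range_succ,
      if_neg (by omega : ¬ x % 2 = (p + 1) % 2), if_pos (by omega : (x + 1) % 2 = (p + 1) % 2),
      add_zero]
  induction x using Nat.twoStepInduction with
  | zero =>
    obtain ⟨M, rfl⟩ : ∃ M, p = 2 * M + 2 := ⟨p / 2 - 1, by omega⟩
    have h : (2 * M + 2) / 2 - 1 = M := by omega
    rw [if_pos hx.symm, ballot_zero_right, h]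
    simp
  | one =>
    obtain ⟨r, rfl⟩ : ∃ r, p = 2 * r + 1 := ⟨p / 2, by omega⟩
    rw [if_neg (by omega), ballot_one_right, Finset.sum_filter, Finset.sum_range_one,
      if_pos (by omega), zero_add]
  | more x ih _ =>
    have hx' : x % 2 = p % 2 := by omega
    rw [ballot_add_two hp hx', ih hx', step x hx']
    ring

end BallotNumbers

/-! ### Steps of a path between heights `0` and `1` -/

section Crossings

variable {α : Type*} [DecidableEq α] {pos : α → ℕ} {η : α → ℤ} {s : Finset α}

/-- The number of steps between the heights `0` and `1` of the path that starts at height `h` and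
has the increments `η i`, for `i ∈ s`. -/
def crossings (pos : α → ℕ) (η : α → ℤ) (h : ℤ) (s : Finset α) : ℕ :=
  (s.filter fun j => (h + ∑ i ∈ s with pos i < pos j, η i = 0 ∨
      h + ∑ i ∈ s with pos i < pos j, η i = 1) ∧
    (h + ∑ i ∈ s with pos i < pos j, η i + η j = 0 ∨
      h + ∑ i ∈ s with pos i < pos j, η i + η j = 1)).card

theorem sum_lt_insert_self {m : α} (hm : ∀ i ∈ s, pos m < pos i) :
    ∑ i ∈ insert m s with pos i < pos m, η i = 0 := by
  rw [Finset.filter_false_of_mem, Finset.sum_empty]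
  intro i hi
  rcases Finset.mem_insert.1 hi with rfl | hi
  · exact lt_irrefl _
  · exact (hm i hi).asymm

theorem sum_lt_insert {m j : α} (hm : ∀ i ∈ s, pos m < pos i) (hj : j ∈ s) :
    ∑ i ∈ insert m s with pos i < pos j, η i = η m + ∑ i ∈ s with pos i < pos j, η i := by
  rw [Finset.filter_insert, if_pos (hm j hj), Finset.sum_insert]
  exact fun h => lt_irrefl _ (hm m (Finset.mem_filter.1 h).1)

theorem crossings_insert {m : α} (hm : ∀ i ∈ s, pos m < pos i) (h : ℤ) :
    crossings pos η h (insert m s) =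
      (if (h = 0 ∨ h = 1) ∧ (h + η m = 0 ∨ h + η m = 1) then 1 else 0) +
        crossings pos η (h + η m) s := by
  have hms : m ∉ s := fun h => lt_irrefl _ (hm m h)
  rw [crossings, Finset.card_filter, Finset.sum_insert hms, sum_lt_insert_self hm, add_zero,
    crossings, Finset.card_filter]
  refine congrArg₂ _ rfl (Finset.sum_congr rfl fun j hj => ?_)
  rw [sum_lt_insert hm hj]
  simp only [add_assoc]

/-- A step changes whether the height is at least `1` exactly when it is a crossing, and the path
ends at height `0`. -/
theorem crossings_mod_two (hpos : pos.Injective) (hη : ∀ i, η i = 1 ∨ η i = -1) (s : Finset α) :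
    ∀ h : ℤ, h + ∑ i ∈ s, η i = 0 → crossings pos η h s % 2 = if 1 ≤ h then 1 else 0 := by
  induction s using Finset.induction_on_min_value pos with
  | empty =>
    intro h hh
    simp at hh
    simp [crossings, hh]
  | insert m s hms hm ih =>
    intro h hh
    have hm' : ∀ i ∈ s, pos m < pos i := fun i hi =>
      lt_of_le_of_ne (hm i hi) fun e => hms (hpos e ▸ hi)
    rw [Finset.sum_insert hms, ← add_assoc] at hh
    have := ih _ hh
    rw [crossings_insert hm']
    have := hη m
    grind

/-- Label each crossing by the number `y` of crossings after it. Every `y` below the total occurs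
once, and since the path ends at `0` the parity of `y` tells at which height the crossing starts. -/
theorem sum_crossings (hpos : pos.Injective) (hη : ∀ i, η i = 1 ∨ η i = -1) (f : ℕ → ℤ) (a : ℕ)
    (ha : a = 0 ∨ a = 1) (s : Finset α) :
    ∀ h : ℤ, h + ∑ i ∈ s, η i = 0 →
      (∑ j ∈ s, if h + ∑ i ∈ s with pos i < pos j, η i = a ∧ (a + η j = 0 ∨ a + η j = 1) then
          f (crossings pos η (a + η j) {i ∈ s | pos j < pos i}) else 0) =
        ∑ y ∈ Finset.range (crossings pos η h s) with y % 2 = (a + 1) % 2, f y := by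
  induction s using Finset.induction_on_min_value pos with
  | empty => intro h hh; simp [crossings]
  | insert m s hms hm ih =>
    intro h hh
    have hm' : ∀ i ∈ s, pos m < pos i := fun i hi =>
      lt_of_le_of_ne (hm i hi) fun e => hms (hpos e ▸ hi)
    rw [Finset.sum_insert hms, ← add_assoc] at hh
    have hfm : {i ∈ insert m s | pos m < pos i} = s := by
      ext i
      simp only [Finset.mem_filter, Finset.mem_insert]
      grind
    rw [Finset.sum_insert hms, crossings_insert hm', sum_lt_insert_self hm', hfm, add_zero]
    have htail : (∑ j ∈ s, if h + ∑ i ∈ insert m s with pos i < pos j, η i = a ∧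
          (a + η j = 0 ∨ a + η j = 1) then
          f (crossings pos η (a + η j) {i ∈ insert m s | pos j < pos i}) else 0) =
        ∑ y ∈ Finset.range (crossings pos η (h + η m) s) with y % 2 = (a + 1) % 2, f y := by
      rw [← ih _ hh]
      refine Finset.sum_congr rfl fun j hj => ?_
      rw [sum_lt_insert hm' hj, Finset.filter_insert, if_neg (hm' j hj).asymm, add_assoc]
    rw [htail]
    have hpar := crossings_mod_two hpos hη s _ hh
    have hηm := hη m
    by_cases hc : (h = 0 ∨ h = 1) ∧ (h + η m = 0 ∨ h + η m = 1)
    · have hsucc : ∀ x, ∑ y ∈ Finset.range (x + 1) with y % 2 = (a + 1) % 2, f y =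
          (if x % 2 = (a + 1) % 2 then f x else 0) +
            ∑ y ∈ Finset.range x with y % 2 = (a + 1) % 2, f y := by
        intro x
        rw [Finset.sum_filter, Finset.sum_filter, Finset.sum_range_succ, add_comm]
      rw [if_pos hc, add_comm 1, hsucc]
      congr 1
      -- A first step that crosses from `a` has the label of the parity counted and adds the top
      -- term of the range; one that crosses from `1 - a` has the other parity, and neither side
      -- changes.
      by_cases hha : h = a
      · rw [if_pos ⟨hha, hha ▸ hc.2⟩, if_pos, ← hha]
        grind
      · rw [if_neg (fun hcon => hha hcon.1), if_neg]
        grind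
    · rw [if_neg hc, zero_add, if_neg, zero_add]
      rintro ⟨rfl, hcon⟩
      exact hc ⟨by simpa using ha, hcon⟩

end Crossings

/-! ### The moment-cumulant formula for the signed Catalan weights -/

section AlternatingWeight

variable {α : Type*} [DecidableEq α] {pos : α → ℕ} {η : α → ℤ} {P V s : Finset α}

/-- The partial sums of `η` over `V` stay in `{0, 1}`: the signs alternate, beginning with `1`. -/
def AltFromOne (pos : α → ℕ) (η : α → ℤ) (V : Finset α) : Prop :=
  ∀ j ∈ V, ∑ i ∈ V with pos i ≤ pos j, η i = 0 ∨ ∑ i ∈ V with pos i ≤ pos j, η i = 1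

open Classical in
/-- The cumulants of a Haar unitary: signed Catalan numbers on the alternating blocks of even
cardinality. -/
noncomputable def haarWeight (pos : α → ℕ) (η : α → ℤ) (V : Finset α) : ℂ :=
  if ∑ i ∈ V, η i = 0 ∧ (AltFromOne pos η V ∨ AltFromOne pos (-η) V) then
    (-1) ^ (V.card / 2 - 1) * (catalan (V.card / 2 - 1) : ℂ)
  else 0

omit [DecidableEq α] in
theorem haarWeight_neg : haarWeight pos (-η) V = haarWeight pos η V := by
  have h : (∑ i ∈ V, (-η) i = 0 ∧ (AltFromOne pos (-η) V ∨ AltFromOne pos (- -η) V)) ↔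
      (∑ i ∈ V, η i = 0 ∧ (AltFromOne pos η V ∨ AltFromOne pos (-η) V)) := by
    rw [neg_neg, or_comm]
    simp only [Pi.neg_apply, Finset.sum_neg_distrib, neg_eq_zero]
  unfold haarWeight
  split_ifs <;> tauto

theorem sum_mod_two (hη : ∀ i, η i = 1 ∨ η i = -1) (V : Finset α) :
    (∑ i ∈ V, η i) % 2 = (V.card : ℤ) % 2 := by
  induction V using Finset.induction_on with
  | empty => simp
  | insert a V ha ih =>
    rw [Finset.sum_insert ha, Finset.card_insert_of_notMem ha]
    have := hη a
    push_cast
    omega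

omit [DecidableEq α] in
theorem AltFromOne.sum_eq (h : AltFromOne pos η P) (hP : P.Nonempty) :
    ∑ i ∈ P, η i = 0 ∨ ∑ i ∈ P, η i = 1 := by
  obtain ⟨j, hj, hmax⟩ := Finset.exists_max_image P pos hP
  have := h j hj
  rwa [Finset.filter_true_of_mem hmax] at this

theorem altFromOne_insert {j : α} (hj : ∀ i ∈ P, pos i < pos j) (h : AltFromOne pos η P)
    (hsum : ∑ i ∈ P, η i + η j = 0 ∨ ∑ i ∈ P, η i + η j = 1) :
    AltFromOne pos η (insert j P) := by
  have hjP : j ∉ P := fun h => lt_irrefl _ (hj j h)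
  intro k hk
  rcases Finset.mem_insert.1 hk with rfl | hk
  · rw [Finset.filter_true_of_mem, Finset.sum_insert hjP, add_comm]
    · exact hsum
    · intro i hi
      rcases Finset.mem_insert.1 hi with rfl | hi
      · exact le_rfl
      · exact (hj i hi).le
  · rw [Finset.filter_insert, if_neg (hj k hk).not_ge]
    exact h k hk

/-- A successor `j` that takes the partial sum out of `{0, 1}` spoils the alternation of every block
extending `insert j P` to the right. -/
theorem haarWeight_eq_zero_of_subset (hη : ∀ i, η i = 1 ∨ η i = -1) (hpos : pos.Injective)
    (hP : P.Nonempty) (h : AltFromOne pos η P) {j : α} (hj : ∀ i ∈ P, pos i < pos j)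
    (hsum : ¬ (∑ i ∈ P, η i + η j = 0 ∨ ∑ i ∈ P, η i + η j = 1)) {B : Finset α}
    (hjB : insert j P ⊆ B) (hB : ∀ i ∈ B, i ∈ insert j P ∨ pos j < pos i) :
    haarWeight pos η B = 0 := by
  have hjP : j ∉ P := fun h => lt_irrefl _ (hj j h)
  refine if_neg ?_
  rintro ⟨-, hB' | hB'⟩
  · have := hB' j (hjB (Finset.mem_insert_self j P))
    have hf : {i ∈ B | pos i ≤ pos j} = insert j P := by
      ext i
      simp only [Finset.mem_filter]
      constructor
      · rintro ⟨hi, hij⟩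
        exact (hB i hi).resolve_right hij.not_gt
      · intro hi
        refine ⟨hjB hi, ?_⟩
        rcases Finset.mem_insert.1 hi with rfl | hi
        · exact le_rfl
        · exact (hj i hi).le
    rw [hf, Finset.sum_insert hjP, add_comm] at this
    exact hsum this
  -- Alternation beginning with `-1` is excluded at once: the first element of `B` is that of `P`,
  -- whose sign is `1`.
  · obtain ⟨m, hm, hmin⟩ := Finset.exists_min_image P pos hP
    have hf : ∀ C : Finset α, m ∈ C → (∀ i ∈ C, pos m ≤ pos i) →
        {i ∈ C | pos i ≤ pos m} = {m} := by
      intro C hmC hC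
      ext i
      simp only [Finset.mem_filter, Finset.mem_singleton]
      constructor
      · rintro ⟨hi, him⟩
        exact hpos (le_antisymm him (hC i hi))
      · rintro rfl
        exact ⟨hmC, le_rfl⟩
    have h₁ := h m hm
    have hmB := hjB (Finset.mem_insert_of_mem hm)
    have h₂ := hB' m hmB
    rw [hf P hm hmin, Finset.sum_singleton] at h₁
    rw [hf B hmB, Finset.sum_singleton, Pi.neg_apply] at h₂
    · have := hη m
      omega
    · intro i hi
      rcases hB i hi with hi | hi
      · rcases Finset.mem_insert.1 hi with rfl | hi
        · exact (hj m hm).le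
        · exact hmin i hi
      · exact ((hj m hm).trans hi).le

theorem sum_eq_lt_add_gt (hpos : pos.Injective) {j : α} (hj : j ∈ s) :
    ∑ i ∈ s, η i = ∑ i ∈ s with pos i < pos j, η i + (η j + ∑ i ∈ s with pos j < pos i, η i) := by
  have hset : s = {i ∈ s | pos i < pos j} ∪ insert j {i ∈ s | pos j < pos i} := by
    ext i
    have := @hpos i j
    simp only [Finset.mem_union, Finset.mem_filter, Finset.mem_insert]
    grind
  conv_lhs => rw [hset]
  rw [Finset.sum_union, Finset.sum_insert]
  · simp
  · refine Finset.disjoint_left.2 fun i hi hi' => ?_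
    simp only [Finset.mem_filter, Finset.mem_insert] at hi hi'
    grind

omit [DecidableEq α] in
theorem haarWeight_of_altFromOne (h : AltFromOne pos η P) :
    haarWeight pos η P = if ∑ i ∈ P, η i = 0 then
      (-1) ^ (P.card / 2 - 1) * (catalan (P.card / 2 - 1) : ℂ) else 0 := by
  simp [haarWeight, h]

/-- Induction on what remains to the right of `P`: the formula is known on the gaps, so only
crossings from the height of `P` survive as successors, and `sum_crossings` turns the expansion into
the recursion `ballot_eq_add_sum`. -/
theorem ncSum_open_haarWeight (hη : ∀ i, η i = 1 ∨ η i = -1) (hpos : pos.Injective)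
    (n : ℕ) : ∀ P s : Finset α, s.card < n →
    (∀ t ⊆ s, ncSum pos (haarWeight pos η) t (fun _ => True) = if ∑ i ∈ t, η i = 0 then 1 else 0) →
    P.Nonempty → (∀ x ∈ P, ∀ y ∈ s, pos x < pos y) → AltFromOne pos η P →
    ncSum pos (haarWeight pos η) (P ∪ s) (fun F => ∃ B ∈ F, P ⊆ B) =
      ((if ∑ i ∈ P, η i + ∑ i ∈ s, η i = 0 then
        ballot P.card (crossings pos η (∑ i ∈ P, η i) s) else 0 : ℤ) : ℂ) := by
  induction n with
  | zero => exact fun P s hs => absurd hs (Nat.not_lt_zero _)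
  | succ n ih =>
    intro P s hs hZ hP hlt hPalt
    rw [ncSum_open hpos hP hlt, hZ s subset_rfl, haarWeight_of_altFromOne hPalt]
    have hterm : ∀ j ∈ s, ncSum pos (haarWeight pos η) {i ∈ s | pos i < pos j} (fun _ => True) *
        ncSum pos (haarWeight pos η) (insert j P ∪ {i ∈ s | pos j < pos i})
          (fun F => ∃ B ∈ F, insert j P ⊆ B) =
        ((if ∑ i ∈ P, η i + ∑ i ∈ s, η i = 0 then
          if ∑ i ∈ P, η i + ∑ i ∈ s with pos i < pos j, η i = ∑ i ∈ P, η i ∧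
            (∑ i ∈ P, η i + η j = 0 ∨ ∑ i ∈ P, η i + η j = 1) then
            ballot (P.card + 1) (crossings pos η (∑ i ∈ P, η i + η j) {i ∈ s | pos j < pos i})
          else 0 else 0 : ℤ) : ℂ) := by
      intro j hj
      have hjP : ∀ i ∈ P, pos i < pos j := fun i hi => hlt i hi j hj
      have hjP' : j ∉ P := fun h => lt_irrefl _ (hjP j h)
      rw [hZ _ (Finset.filter_subset _ _)]
      have hs' := sum_eq_lt_add_gt (η := η) hpos hj
      by_cases h₁ : ∑ i ∈ s with pos i < pos j, η i = 0
      swap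
      · simp [h₁]
      by_cases h₂ : ∑ i ∈ P, η i + η j = 0 ∨ ∑ i ∈ P, η i + η j = 1
      · rw [ih]
        · rw [Finset.card_insert_of_notMem hjP', Finset.sum_insert hjP', h₁, hs', h₁]
          simp only [h₂, add_comm (η j), add_zero, and_true, if_true, zero_add, one_mul,
            add_assoc]
        · have : {i ∈ s | pos j < pos i} ⊂ s :=
            Finset.filter_ssubset.2 ⟨j, hj, lt_irrefl _⟩
          have := Finset.card_lt_card this
          omega
        · exact fun t ht => hZ t (ht.trans (Finset.filter_subset _ _))
        · exact Finset.insert_nonempty j P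
        · intro x hx y hy
          obtain ⟨hy, hjy⟩ := Finset.mem_filter.1 hy
          rcases Finset.mem_insert.1 hx with rfl | hx
          · exact hjy
          · exact hlt x hx y hy
        · exact altFromOne_insert hjP hPalt h₂
      · simp only [h₂, and_false, if_false, ite_self, Int.cast_zero]
        refine mul_eq_zero_of_right _ (Finset.sum_eq_zero fun F hF => ?_)
        obtain ⟨hF, B, hB, hjB⟩ := mem_ncFamilies.1 hF
        refine Finset.prod_eq_zero hB (haarWeight_eq_zero_of_subset hη hpos hP hPalt hjP h₂ hjB ?_)
        intro i hi
        rcases Finset.mem_union.1 (hF.subset hB hi) with hi | hi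
        · exact Or.inl hi
        · exact Or.inr (Finset.mem_filter.1 hi).2
    rw [Finset.sum_congr rfl hterm]
    by_cases htot : ∑ i ∈ P, η i + ∑ i ∈ s, η i = 0
    · simp only [if_pos htot]
      obtain ⟨a, ha, haP⟩ : ∃ a : ℕ, (a = 0 ∨ a = 1) ∧ ∑ i ∈ P, η i = a := by
        rcases hPalt.sum_eq hP with h | h
        · exact ⟨0, Or.inl rfl, by simpa using h⟩
        · exact ⟨1, Or.inr rfl, by simpa using h⟩
      have hpar := sum_mod_two hη P
      have hcr := crossings_mod_two hpos hη s _ htot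
      have hcard := Finset.card_pos.2 hP
      have hsum := sum_crossings hpos hη (ballot (P.card + 1)) a ha s _ htot
      rw [haP] at hpar hcr htot hsum
      have hcr' : crossings pos η a s % 2 = P.card % 2 := by
        rcases ha with h | h
        · rw [if_neg (by omega)] at hcr
          omega
        · rw [if_pos (by omega)] at hcr
          omega
      rw [← Int.cast_sum, haP, hsum, ballot_eq_add_sum hcard hcr']
      have : (P.card + 1) % 2 = (a + 1) % 2 := by omega
      rw [this]
      push_cast
      congr 1
      -- Closing the block at `P` is possible only at height `0`, where `P.card` is even and the
      -- signs of `s` sum to zero.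
      by_cases ha0 : a = 0
      · have h₁ : ∑ i ∈ s, η i = 0 := by omega
        have h₂ : P.card % 2 = 0 := by omega
        simp [ha0, h₁, h₂]
      · have h₂ : ¬ P.card % 2 = 0 := by omega
        simp [ha0, h₂]
    · have : ¬ (∑ i ∈ P, η i = 0 ∧ ∑ i ∈ s, η i = 0) := by omega
      simp only [if_neg htot]
      simp only [Int.cast_zero, Finset.sum_const_zero, add_zero]
      by_cases h : ∑ i ∈ P, η i = 0
      · rw [if_neg fun h' => this ⟨h, h'⟩, mul_zero]
      · simp [h]

/-- The moment-cumulant formula for a Haar unitary. -/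
theorem ncSum_haarWeight (hη : ∀ i, η i = 1 ∨ η i = -1) (hpos : pos.Injective) (s : Finset α) :
    ncSum pos (haarWeight pos η) s (fun _ => True) = if ∑ i ∈ s, η i = 0 then 1 else 0 := by
  induction s using Finset.strongInduction with
  | H s ih =>
    rcases s.eq_empty_or_nonempty with rfl | hs
    · simp [ncSum_empty]
    obtain ⟨m, hm, hmin⟩ := Finset.exists_min_image s pos hs
    -- Stated for a general `η'` so that it applies to `η` or `-η`: both sides are invariant under
    -- negation, and the first sign may be taken to be `1`.
    have key : ∀ η' : α → ℤ, (∀ i, η' i = 1 ∨ η' i = -1) → η' m = 1 →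
        (∀ t ⊂ s, ncSum pos (haarWeight pos η') t (fun _ => True) =
          if ∑ i ∈ t, η' i = 0 then 1 else 0) →
        ncSum pos (haarWeight pos η') s (fun _ => True) =
          if ∑ i ∈ s, η' i = 0 then 1 else 0 := by
      intro η' hη' hm' ih'
      have h := ncSum_open_haarWeight hη' hpos (s.erase m).card.succ {m} (s.erase m)
        (Nat.lt_succ_self _)
        (fun t ht => ih' t (lt_of_le_of_lt ht (Finset.erase_ssubset hm)))
        (Finset.singleton_nonempty m) ?_ ?_
      · rw [← Finset.insert_eq, Finset.insert_erase hm, Finset.sum_singleton,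
          Finset.card_singleton, Finset.add_sum_erase _ _ hm] at h
        refine Eq.trans (ncSum_congr fun F hF => ?_) (h.trans ?_)
        · obtain ⟨B, hB, hmB⟩ := (hF.mem_iff m).1 hm
          simpa using ⟨B, hB, hmB⟩
        · split_ifs <;> simp [ballot]
      · intro x hx y hy
        rw [Finset.mem_singleton.1 hx]
        obtain ⟨hym, hys⟩ := Finset.mem_erase.1 hy
        exact lt_of_le_of_ne (hmin y hys) fun e => hym (hpos e).symm
      · intro j hj
        obtain rfl := Finset.mem_singleton.1 hj
        simp [Finset.filter_singleton, hm']
    rcases hη m with h | h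
    · exact key η hη h ih
    · have hneg : haarWeight pos (-η) = haarWeight pos η := funext fun V => haarWeight_neg
      have := key (-η) (fun i => by have := hη i; simp only [Pi.neg_apply]; omega) (by simp [h])
      simp only [hneg, Pi.neg_apply, Finset.sum_neg_distrib, neg_eq_zero] at this
      exact this ih

end AlternatingWeight

/-! ### From the moment-cumulant formula to cumulants -/

section Inversion

variable {n : ℕ} {χ : Fin n → Side}

/-- The position of an index in the `χ`-order. -/
def chiPos (χ : Fin n → Side) (i : Fin n) : ℕ := (sPerm χ).symm i

theorem chiPos_injective : (chiPos χ).Injective :=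
  Fin.val_injective.comp (sPerm χ).symm.injective

theorem BNC.isNC (π : BNC χ) : IsNC (chiPos χ) Finset.univ π.1.parts where
  nonempty _ hV := π.1.nonempty_of_mem_parts hV
  eq_of_mem _ hV _ hW _ hxV hxW := π.1.eq_of_mem_parts hV hW hxV hxW
  mem_iff x := ⟨fun hx => π.1.exists_mem hx, fun _ => Finset.mem_univ x⟩
  noncrossing := π.2

theorem IsNC.exists_bnc {F : Finset (Finset (Fin n))} (h : IsNC (chiPos χ) Finset.univ F) :
    ∃ π : BNC χ, π.1.parts = F := by
  let π : Finpartition (Finset.univ : Finset (Fin n)) := Finpartition.ofExistsUnique F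
    (fun V _ => Finset.subset_univ V)
    (fun x hx => by
      obtain ⟨V, hV, hxV⟩ := (h.mem_iff x).1 hx
      exact ⟨V, ⟨hV, hxV⟩, fun W hW => h.eq_of_mem W hW.1 V hV x hW.2 hxV⟩)
    (fun h' => (h.nonempty ∅ h').ne_empty rfl)
  exact ⟨⟨π, h.noncrossing⟩, rfl⟩

theorem isBiNonCrossing_bot (χ : Fin n → Side) :
    IsBiNonCrossing χ (⊥ : Finpartition (Finset.univ : Finset (Fin n))) := by
  intro V hV W _ v₁ hv₁ v₂ hv₂ w₁ _ w₂ _ h₁ h₂ _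
  obtain ⟨a, -, rfl⟩ := Finpartition.mem_bot_iff.1 hV
  rw [Finset.mem_singleton.1 hv₁] at h₁
  rw [Finset.mem_singleton.1 hv₂] at h₂
  exact absurd h₂ (lt_asymm h₁)

noncomputable instance (χ : Fin n → Side) : OrderBot (BNC χ) where
  bot := ⟨⊥, isBiNonCrossing_bot χ⟩
  bot_le π := (bot_le : (⊥ : Finpartition (Finset.univ : Finset (Fin n))) ≤ π.1)

theorem sum_Iic_prod_parts (g : Finset (Fin n) → ℂ) (σ : BNC χ) :
    ∑ π ∈ Finset.Iic σ, ∏ V ∈ π.1.parts, g V =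
      ∏ U ∈ σ.1.parts, ncSum (chiPos χ) g U fun _ => True := by
  rw [← ncSum_refine σ.isNC, ncSum]
  refine Finset.sum_bij (fun π _ => π.1.parts) ?_ ?_ ?_ fun _ _ => rfl
  · intro π hπ
    exact mem_ncFamilies.2 ⟨π.isNC, fun V hV => Finset.mem_Iic.1 hπ hV⟩
  · intro π _ π' _ h
    exact Subtype.ext (Finpartition.ext h)
  · intro F hF
    obtain ⟨hF, hFσ⟩ := mem_ncFamilies.1 hF
    obtain ⟨π, rfl⟩ := hF.exists_bnc
    exact ⟨π, Finset.mem_Iic.2 fun V hV => hFσ V hV, rfl⟩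

variable {A : Type*} [Ring A] [Algebra ℂ A]

/-- Sums over refinements factor over blocks, so a moment formula on all subsets gives one on all of
`BNC χ`, and Möbius inversion at the maximal element recovers the weight. -/
theorem cumulant_eq_of_moment_eq (φ : A →ₗ[ℂ] ℂ) (hn : n ≠ 0) (a : Fin n → A)
    (g : Finset (Fin n) → ℂ)
    (h : ∀ V, blockMoment φ a V = ncSum (chiPos χ) g V fun _ => True) :
    cumulant φ χ a = g Finset.univ := by
  classical
  have hinv := IncidenceAlgebra.moebius_inversion_bot (fun π : BNC χ => ∏ V ∈ π.1.parts, g V)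
    (fun π => partitionMoment φ π.1 a)
    (fun σ => by
      rw [sum_Iic_prod_parts]
      exact Finset.prod_congr rfl fun V _ => h V)
    (oneBNC χ)
  -- This needs `n ≠ 0`: the partition of the empty set has no blocks.
  have htop : (oneBNC χ).1.parts = {Finset.univ} := by
    have hsub : (oneBNC χ).1.parts ⊆ {Finset.univ} := Finpartition.parts_top_subset _
    obtain ⟨V, hV, -⟩ := (oneBNC χ).1.exists_mem
      (Finset.mem_univ (⟨0, Nat.pos_of_ne_zero hn⟩ : Fin n))
    exact Finset.Subset.antisymm hsub
      (Finset.singleton_subset_iff.2 (Finset.mem_singleton.1 (hsub hV) ▸ hV))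
  simp only [htop, Finset.prod_singleton] at hinv
  rw [hinv, cumulant, cumulantAt]
  refine Finset.sum_congr ?_ fun π _ => ?_
  · ext π
    simp
  · rw [mul_comm, muBNC]

end Inversion

/-! ### Alternation as a condition on consecutive entries -/

section ConsecutiveSigns

variable {n : ℕ} {χ : Fin n → Side} {η : Fin n → ℤ}

theorem chiPos_sPerm (k : Fin n) : chiPos χ (sPerm χ k) = k := by
  simp [chiPos]

theorem sum_chiPos_succ (η : Fin n → ℤ) (k : Fin n) :
    ∑ i with chiPos χ i < (k : ℕ) + 1, η i =
      ∑ i with chiPos χ i < (k : ℕ), η i + η (sPerm χ k) := by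
  have hset : Finset.univ.filter (fun i => chiPos χ i < (k : ℕ) + 1) =
      insert (sPerm χ k) (Finset.univ.filter fun i => chiPos χ i < (k : ℕ)) := by
    ext i
    have h := chiPos_sPerm (χ := χ) k
    have := @chiPos_injective _ χ i (sPerm χ k)
    simp only [Finset.mem_filter, Finset.mem_univ, true_and, Finset.mem_insert]
    grind
  rw [hset, Finset.sum_insert, add_comm]
  simp [chiPos_sPerm]

theorem altFromOne_chiPos_iff : AltFromOne (chiPos χ) η Finset.univ ↔
    ∀ k : Fin n, ∑ i with chiPos χ i < (k : ℕ) + 1, η i = 0 ∨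
      ∑ i with chiPos χ i < (k : ℕ) + 1, η i = 1 := by
  simp only [AltFromOne, Finset.mem_univ, true_imp_iff, ← Nat.lt_succ_iff]
  rw [← (sPerm χ).forall_congr_right]
  simp only [chiPos_sPerm, Nat.succ_eq_add_one]

theorem AltFromOne.consecutive (h : AltFromOne (chiPos χ) η Finset.univ)
    (hη : ∀ i, η i = 1 ∨ η i = -1) (i j : Fin n) (hij : (i : ℕ) + 1 = j) :
    η (sPerm χ i) = -η (sPerm χ j) := by
  rw [altFromOne_chiPos_iff] at h
  have h₀ : ∑ x with chiPos χ x < (i : ℕ), η x = 0 ∨ ∑ x with chiPos χ x < (i : ℕ), η x = 1 := by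
    rcases Nat.eq_zero_or_pos (i : ℕ) with hi | hi
    · simp [hi]
    · have := h ⟨i - 1, by omega⟩
      simpa only [Nat.sub_add_cancel hi] using this
  have h₁ := h i
  have h₂ := h j
  have e₂ := sum_chiPos_succ (χ := χ) η j
  rw [sum_chiPos_succ] at h₁
  rw [e₂, ← hij, sum_chiPos_succ] at h₂
  have hi := hη (sPerm χ i)
  have hj := hη (sPerm χ j)
  omega

theorem altFromOne_of_consecutive (hn : 0 < n)
    (h : ∀ i j : Fin n, (i : ℕ) + 1 = j → η (sPerm χ i) = -η (sPerm χ j))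
    (h₀ : η (sPerm χ ⟨0, hn⟩) = 1) : AltFromOne (chiPos χ) η Finset.univ := by
  rw [altFromOne_chiPos_iff]
  -- Invariant of the path: it is at `0` and about to go up, or at `1` and about to go down.
  have key : ∀ k (hk : k < n),
      (∑ x with chiPos χ x < k, η x = 0 ∧ η (sPerm χ ⟨k, hk⟩) = 1) ∨
      (∑ x with chiPos χ x < k, η x = 1 ∧ η (sPerm χ ⟨k, hk⟩) = -1) := by
    intro k
    induction k with
    | zero => intro hk; exact Or.inl ⟨by simp, h₀⟩
    | succ k ih =>
      intro hk
      have h₁ := ih (by omega)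
      have h₂ := h ⟨k, by omega⟩ ⟨k + 1, hk⟩ rfl
      have h₃ := sum_chiPos_succ (χ := χ) η ⟨k, by omega⟩
      simp only at h₃
      rw [h₃]
      omega
  intro k
  have := key k k.2
  rw [Fin.eta] at this
  rw [sum_chiPos_succ]
  omega

theorem altFromOne_or_neg_iff (hη : ∀ i, η i = 1 ∨ η i = -1) (hn : 0 < n) :
    (AltFromOne (chiPos χ) η Finset.univ ∨ AltFromOne (chiPos χ) (-η) Finset.univ) ↔
      ∀ i j : Fin n, (i : ℕ) + 1 = j → η (sPerm χ i) = -η (sPerm χ j) := by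
  constructor
  · rintro (h | h)
    · exact h.consecutive hη
    · intro i j hij
      have := h.consecutive (fun i => by have := hη i; simp only [Pi.neg_apply]; omega) i j hij
      simp only [Pi.neg_apply] at this
      omega
  · intro h
    rcases hη (sPerm χ ⟨0, hn⟩) with h₀ | h₀
    · exact Or.inl (altFromOne_of_consecutive hn h h₀)
    · refine Or.inr (altFromOne_of_consecutive hn (fun i j hij => ?_) ?_)
      · simp only [Pi.neg_apply, h i j hij]
      · simp only [Pi.neg_apply, h₀, neg_neg]

theorem haarWeight_univ_of_consecutive {m : ℕ} {χ : Fin (2 * m) → Side} {η : Fin (2 * m) → ℤ}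
    (hm : 1 ≤ m) (hη : ∀ i, η i = 1 ∨ η i = -1)
    (h : ∀ i j : Fin (2 * m), (i : ℕ) + 1 = j → η (sPerm χ i) = -η (sPerm χ j)) :
    haarWeight (chiPos χ) η Finset.univ = (-1) ^ (m - 1) * (catalan (m - 1) : ℂ) := by
  have hn : 0 < 2 * m := by omega
  have hne : (Finset.univ : Finset (Fin (2 * m))).Nonempty := ⟨⟨0, hn⟩, Finset.mem_univ _⟩
  have halt := (altFromOne_or_neg_iff hη hn).2 h
  have hpar := sum_mod_two hη Finset.univ
  rw [Finset.card_univ, Fintype.card_fin] at hpar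
  -- Up to a global sign the sum is `0` or `1`, and it is even because there are `2 * m` signs.
  have hsum : ∑ i, η i = 0 := by
    rcases halt with h | h <;> have := h.sum_eq hne
    · omega
    · simp only [Pi.neg_apply, Finset.sum_neg_distrib] at this
      omega
  rw [haarWeight, if_pos ⟨hsum, halt⟩, Finset.card_univ, Fintype.card_fin]
  simp

theorem haarWeight_univ_eq_zero (hη : ∀ i, η i = 1 ∨ η i = -1) (hn : 0 < n)
    (h : ¬ (Even n ∧ ∀ i j : Fin n, (i : ℕ) + 1 = j → η (sPerm χ i) = -η (sPerm χ j))) :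
    haarWeight (chiPos χ) η Finset.univ = 0 := by
  refine if_neg ?_
  rintro ⟨hsum, halt⟩
  have hpar := sum_mod_two hη Finset.univ
  rw [Finset.card_univ, Fintype.card_fin, hsum] at hpar
  exact h ⟨Nat.even_iff.2 (by omega), (altFromOne_or_neg_iff hη hn).1 halt⟩

end ConsecutiveSigns

/-! ### Moments of words in the bi-Haar pair -/

section Moments

variable {A : Type*} [Ring A] [StarRing A] [Algebra ℂ A] {φ : A →ₗ[ℂ] ℂ} {u_l u_r : unitary A}

theorem IsBiHaarUnitaryPair.commute_unitary (hu : IsBiHaarUnitaryPair φ u_l u_r) :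
    Commute u_l u_r :=
  Subtype.ext (hu.commute _ (Algebra.subset_adjoin (by simp)) _ (Algebra.subset_adjoin (by simp)))

theorem IsBiHaarUnitaryPair.map_prod (hu : IsBiHaarUnitaryPair φ u_l u_r) {ι : Type*}
    (a : ι → A) (ε : ι → ℤ)
    (ha : ∀ i, ∃ p q : ℤ, a i = ((u_l ^ p * u_r ^ q : unitary A) : A) ∧ p + q = ε i)
    (w : List ι) : φ (w.map a).prod = if (w.map ε).sum = 0 then 1 else 0 := by
  obtain ⟨p, q, hw, hpq⟩ : ∃ p q : ℤ, (w.map a).prod = ((u_l ^ p * u_r ^ q : unitary A) : A) ∧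
      p + q = (w.map ε).sum := by
    induction w with
    | nil => exact ⟨0, 0, by simp, by simp⟩
    | cons i w ih =>
      obtain ⟨p, q, h, hpq⟩ := ha i
      obtain ⟨p', q', h', hpq'⟩ := ih
      refine ⟨p + p', q + q', ?_, ?_⟩
      · rw [List.map_cons, List.prod_cons, h, h', ← Submonoid.coe_mul, zpow_add, zpow_add]
        have := (hu.commute_unitary.zpow_zpow p' q).eq
        congr 1
        rw [mul_assoc, mul_assoc, ← mul_assoc (u_r ^ q), ← this, mul_assoc]
      · rw [List.map_cons, List.sum_cons, ← hpq, ← hpq']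
        ring
  rw [hw, ← hpq, Submonoid.coe_mul, hu.moments]

theorem IsBiHaarUnitaryPair.blockMoment_eq (hu : IsBiHaarUnitaryPair φ u_l u_r) {n : ℕ}
    (a : Fin n → A) (ε : Fin n → ℤ)
    (ha : ∀ i, ∃ p q : ℤ, a i = ((u_l ^ p * u_r ^ q : unitary A) : A) ∧ p + q = ε i)
    (V : Finset (Fin n)) : blockMoment φ a V = if ∑ i ∈ V, ε i = 0 then 1 else 0 := by
  rw [blockMoment, hu.map_prod a ε ha]
  have h := List.sum_toFinset ε (V.sort_nodup (· ≤ ·))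
  rw [Finset.sort_toFinset] at h
  rw [h]

/-- Equality would give `x * y = 1`, while `φ` vanishes on `x * y`, a word of total sign `2`. This
makes signs readable from elements of `A`; `u_l` and `u_r` themselves may coincide. -/
theorem IsBiHaarUnitaryPair.ne_star (hu : IsBiHaarUnitaryPair φ u_l u_r) {x y : A}
    (hx : x = u_l ∨ x = u_r) (hy : y = u_l ∨ y = u_r) : x ≠ star y := by
  have h₁ : φ 1 = 1 := by simpa using hu.moments 0 0
  have h₂ : star y * y = 1 := by
    rcases hy with rfl | rfl
    · exact Unitary.coe_star_mul_self u_l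
    · exact Unitary.coe_star_mul_self u_r
  have h₃ : φ (x * y) = 0 := by
    have hc : (u_r : A) * u_l = u_l * u_r := congrArg Subtype.val hu.commute_unitary.eq.symm
    rcases hx with rfl | rfl <;> rcases hy with rfl | rfl
    · simpa [pow_two, zpow_ofNat] using hu.moments 2 0
    · simpa using hu.moments 1 1
    · simpa [hc] using hu.moments 1 1
    · simpa [pow_two, zpow_ofNat] using hu.moments 0 2
  rintro rfl
  rw [h₂, h₁] at h₃
  exact one_ne_zero h₃

/-- Words in a bi-Haar unitary pair have signs which describe both the moments and the `*`-terms. -/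
theorem IsBiHaarUnitaryPair.exists_signs (hu : IsBiHaarUnitaryPair φ u_l u_r) {n : ℕ}
    (a : Fin n → A)
    (ha : ∀ i, a i = u_l ∨ a i = star (u_l : A) ∨ a i = u_r ∨ a i = star (u_r : A)) :
    ∃ ε : Fin n → ℤ, (∀ i, ε i = 1 ∨ ε i = -1) ∧
      (∀ V, blockMoment φ a V = if ∑ i ∈ V, ε i = 0 then 1 else 0) ∧
      ∀ χ : Fin n → Side,
        IsStarAlternating (u_l : A) (u_r : A) (fun k => a (sPerm χ k)) ↔
          ∀ i j : Fin n, (i : ℕ) + 1 = j → ε (sPerm χ i) = -ε (sPerm χ j) := by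
  have h : ∀ i, ∃ e : ℤ, (e = 1 ∨ e = -1) ∧
      (∃ p q : ℤ, a i = ((u_l ^ p * u_r ^ q : unitary A) : A) ∧ p + q = e) ∧
      ((a i = u_l ∨ a i = u_r) ↔ e = 1) ∧
      ((a i = star (u_l : A) ∨ a i = star (u_r : A)) ↔ e = -1) := by
    intro i
    have hne := @IsBiHaarUnitaryPair.ne_star _ _ _ _ _ _ _ hu
    have e₁ : ((u_l ^ (-1 : ℤ) : unitary A) : A) = star (u_l : A) := by
      rw [zpow_neg_one, ← Unitary.star_eq_inv, Unitary.coe_star]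
    have e₂ : ((u_r ^ (-1 : ℤ) : unitary A) : A) = star (u_r : A) := by
      rw [zpow_neg_one, ← Unitary.star_eq_inv, Unitary.coe_star]
    rcases ha i with h | h | h | h
    · refine ⟨1, by simp, ⟨1, 0, by simp [h], by simp⟩, by simp [h], ?_⟩
      simp only [h, hne (Or.inl rfl) (Or.inl rfl), hne (Or.inl rfl) (Or.inr rfl)]
      norm_num
    · refine ⟨-1, by simp, ⟨-1, 0, by rw [zpow_zero, mul_one, e₁, h], by simp⟩, ?_, by simp [h]⟩
      simp only [h, (hne (Or.inl rfl) (Or.inl rfl)).symm, (hne (Or.inr rfl) (Or.inl rfl)).symm]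
      norm_num
    · refine ⟨1, by simp, ⟨0, 1, by simp [h], by simp⟩, by simp [h], ?_⟩
      simp only [h, hne (Or.inr rfl) (Or.inl rfl), hne (Or.inr rfl) (Or.inr rfl)]
      norm_num
    · refine ⟨-1, by simp, ⟨0, -1, by rw [zpow_zero, one_mul, e₂, h], by simp⟩, ?_, by simp [h]⟩
      simp only [h, (hne (Or.inl rfl) (Or.inr rfl)).symm, (hne (Or.inr rfl) (Or.inr rfl)).symm]
      norm_num
  choose ε hε hmom hpos hneg using h
  refine ⟨ε, hε, hu.blockMoment_eq a ε hmom, fun χ => ?_⟩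
  refine forall_congr' fun i => forall_congr' fun j => imp_congr_right fun _ => ?_
  simp only [hpos, hneg]
  have h₁ := hε (sPerm χ i)
  have h₂ := hε (sPerm χ j)
  omega

theorem IsBiHaarUnitaryPair.exists_cumulant_eq (hu : IsBiHaarUnitaryPair φ u_l u_r) {n : ℕ}
    (hn : 1 ≤ n) (χ : Fin n → Side) (a : Fin n → A)
    (ha : ∀ i, a i = u_l ∨ a i = star (u_l : A) ∨ a i = u_r ∨ a i = star (u_r : A)) :
    ∃ ε : Fin n → ℤ, (∀ i, ε i = 1 ∨ ε i = -1) ∧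
      cumulant φ χ a = haarWeight (chiPos χ) ε Finset.univ ∧
      (IsStarAlternating (u_l : A) (u_r : A) (fun k => a (sPerm χ k)) ↔
        ∀ i j : Fin n, (i : ℕ) + 1 = j → ε (sPerm χ i) = -ε (sPerm χ j)) := by
  obtain ⟨ε, hε, hmom, halt⟩ := hu.exists_signs a ha
  refine ⟨ε, hε, cumulant_eq_of_moment_eq φ (by omega) a _ fun V => ?_, halt χ⟩
  rw [hmom, ncSum_haarWeight hε chiPos_injective]

omit [Algebra ℂ A] in
theorem Compatible.entry {X Y : A} {n : ℕ} {χ : Fin n → Side} {a : Fin n → A}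
    (h : Compatible X Y χ a) (i : Fin n) : a i = X ∨ a i = star X ∨ a i = Y ∨ a i = star Y := by
  cases hi : χ i
  · exact ((h i).1 hi).elim Or.inl fun h => Or.inr (Or.inl h)
  · exact ((h i).2 hi).elim (fun h => Or.inr (Or.inr (Or.inl h)))
      fun h => Or.inr (Or.inr (Or.inr h))

end Moments

/-! ### Shapes of alternating words -/

section AllowedWords

variable {A : Type*}

/-- The word `f b, f (!b), f b, …` of length `k`. -/
def altWord (f : Bool → A) : ℕ → Bool → List A
  | 0, _ => []
  | k + 1, b => f b :: altWord f k (!b)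

theorem altWord_two_mul (f : Bool → A) (b : Bool) (p : ℕ) :
    altWord f (2 * p) b = repeatPair p (f b) (f !b) := by
  induction p with
  | zero => rfl
  | succ p ih =>
    have : 2 * (p + 1) = 2 * p + 1 + 1 := by ring
    rw [this, altWord, altWord, Bool.not_not, ih]
    simp [repeatPair, List.replicate_succ]

theorem altWord_two_mul_add_one (f : Bool → A) (b : Bool) (p : ℕ) :
    altWord f (2 * p + 1) b = repeatPair p (f b) (f !b) ++ [f b] := by
  induction p with
  | zero => rfl
  | succ p ih =>
    have : 2 * (p + 1) + 1 = 2 * p + 1 + 1 + 1 := by ring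
    rw [this, altWord, altWord, Bool.not_not, ih]
    simp [repeatPair, List.replicate_succ]

theorem exists_eq_altWord {R : A → A → Prop} {y : Bool → A}
    (hyy : ∀ b c, R (y b) (y c) → c = !b) (w : List A) (hw : ∀ z ∈ w, ∃ b, z = y b)
    (h : w.IsChain R) : ∃ b, w = altWord y w.length b := by
  induction w with
  | nil => exact ⟨true, rfl⟩
  | cons z w ih =>
    obtain ⟨b₀, rfl⟩ := hw z (by simp)
    obtain ⟨b, hb⟩ := ih (fun z hz => hw z (by simp [hz])) h.tail
    refine ⟨b₀, ?_⟩
    cases w with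
    | nil => rfl
    | cons z' w =>
      have hz' : z' = y b := by simpa [altWord] using (List.cons.inj hb).1
      rw [List.isChain_cons_cons] at h
      rw [hyy b₀ b (hz' ▸ h.1)] at hb
      rw [List.length_cons, altWord, ← hb]

/-- The alternation continues across the junction, so the first letter and the parity of the length
of `w` determine the first letter of `v`. -/
theorem exists_eq_altWord_append {R : A → A → Prop} {x y : Bool → A}
    (hxx : ∀ b c, R (x b) (x c) → c = !b) (hxy : ∀ b c, R (x b) (y c) → c = !b)
    (hyy : ∀ b c, R (y b) (y c) → c = !b) (w v : List A) (hw : ∀ z ∈ w, ∃ b, z = x b)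
    (hv : ∀ z ∈ v, ∃ b, z = y b) (h : (w ++ v).IsChain R) :
    ∃ b, w = altWord x w.length b ∧ v = altWord y v.length (xor b w.length.bodd) := by
  induction w with
  | nil =>
    obtain ⟨b, hb⟩ := exists_eq_altWord hyy v hv h
    exact ⟨b, rfl, by simpa using hb⟩
  | cons z w ih =>
    obtain ⟨b₀, rfl⟩ := hw z (by simp)
    obtain ⟨b, hb, hb'⟩ := ih (fun z hz => hw z (by simp [hz])) h.tail
    have hpar : xor b₀ (w.length + 1).bodd = xor (!b₀) w.length.bodd := by
      rw [Nat.bodd_succ]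
      cases b₀ <;> simp
    refine ⟨b₀, ?_⟩
    rw [List.length_cons, altWord, hpar]
    cases w with
    | nil =>
      refine ⟨rfl, ?_⟩
      cases v with
      | nil => rfl
      | cons z' v =>
        have hz' : z' = y b := by simpa [altWord] using (List.cons.inj hb').1
        rw [List.cons_append, List.nil_append, List.isChain_cons_cons] at h
        rw [hxy b₀ b (hz' ▸ h.1)] at hb'
        exact hb'
    | cons z' w =>
      have hz' : z' = x b := by simpa [altWord] using (List.cons.inj hb).1
      rw [List.cons_append, List.cons_append, List.isChain_cons_cons] at h
      obtain rfl := hxx b₀ b (hz' ▸ h.1)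
      exact ⟨congrArg _ hb, hb'⟩

variable [Ring A] [StarRing A]

omit [Ring A] [StarRing A] in
theorem ofFn_sPerm {n : ℕ} (χ : Fin n → Side) (a : Fin n → A) :
    (List.ofFn fun k => a (sPerm χ k)) = (chiList χ).map a := by
  refine List.ext_getElem (by simp [length_chiList]) fun k h₁ h₂ => ?_
  simp [sPerm]

/-- In the `χ`-order the left entries precede the right ones. Their numbers `k` and `l` have equal
parity: both even gives shapes (b) and (c), both odd gives (d) and (e), according to the first
letter. -/
theorem isAllowedWord_of_isStarAlternating {X Y : A}
    (hne : ∀ x y : A, (x = X ∨ x = Y) → (y = X ∨ y = Y) → x ≠ star y) {n : ℕ} (hn : Even n)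
    {χ : Fin n → Side} {a : Fin n → A} (ha : Compatible X Y χ a)
    (h : IsStarAlternating X Y fun k => a (sPerm χ k)) :
    IsAllowedWord X Y (List.ofFn fun k => a (sPerm χ k)) := by
  have hchain : (List.ofFn fun k => a (sPerm χ k)).IsChain fun x y =>
      ((x = X ∨ x = Y) ∧ (y = star X ∨ y = star Y)) ∨
      ((x = star X ∨ x = star Y) ∧ (y = X ∨ y = Y)) :=
    List.isChain_ofFn.2 fun i hi => h ⟨i, Nat.lt_of_succ_lt hi⟩ ⟨i + 1, hi⟩ rfl
  have h₁ := hne X X (Or.inl rfl) (Or.inl rfl)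
  have h₂ := hne X Y (Or.inl rfl) (Or.inr rfl)
  have h₃ := hne Y X (Or.inr rfl) (Or.inl rfl)
  have h₄ := hne Y Y (Or.inr rfl) (Or.inr rfl)
  have hlen := length_chiList χ
  rw [ofFn_sPerm, chiList, List.map_append] at hchain ⊢
  rw [chiList, List.length_append] at hlen
  have key := exists_eq_altWord_append (x := fun b => cond b X (star X))
    (y := fun b => cond b Y (star Y)) ?_ ?_ ?_ _ _ ?_ ?_ hchain
  · obtain ⟨b, hw, hv⟩ := key
    rw [List.length_map] at hw hv
    rw [hw, hv, List.length_map]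
    generalize (List.filter (fun i => decide (χ i = Side.l)) (List.finRange n)).length = k at hlen
    generalize (List.filter (fun i => decide (χ i = Side.r)) (List.finRange n)).reverse.length = l
      at hlen
    subst hlen
    rcases Nat.even_or_odd' k with ⟨p, rfl | rfl⟩
    · obtain ⟨q, rfl⟩ : ∃ q, l = 2 * q := ⟨l / 2, by have := Nat.even_iff.1 hn; omega⟩
      rw [altWord_two_mul, altWord_two_mul, Nat.bodd_mul]
      cases b
      · exact Or.inr (Or.inr (Or.inl ⟨p, q, rfl⟩))
      · exact Or.inr (Or.inl ⟨p, q, rfl⟩)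
    · obtain ⟨q, rfl⟩ : ∃ q, l = 2 * q + 1 := ⟨l / 2, by have := Nat.even_iff.1 hn; omega⟩
      rw [altWord_two_mul_add_one, altWord_two_mul_add_one, Nat.bodd_succ, Nat.bodd_mul,
        ← List.append_assoc]
      cases b
      · exact Or.inr (Or.inr (Or.inr (Or.inr ⟨p, q, rfl⟩)))
      · exact Or.inr (Or.inr (Or.inr (Or.inl ⟨p, q, rfl⟩)))
  · rintro (_ | _) (_ | _) <;> grind
  · rintro (_ | _) (_ | _) <;> grind
  · rintro (_ | _) (_ | _) <;> grind
  · intro z hz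
    obtain ⟨i, hi, rfl⟩ := List.mem_map.1 hz
    have hi : χ i = Side.l := by simpa using hi
    exact ((ha i).1 hi).elim (fun h => ⟨true, h⟩) fun h => ⟨false, h⟩
  · intro z hz
    obtain ⟨i, hi, rfl⟩ := List.mem_map.1 hz
    have hi : χ i = Side.r := by simpa using hi
    exact ((ha i).2 hi).elim (fun h => ⟨true, h⟩) fun h => ⟨false, h⟩

end AllowedWords
end BiFree

theorem mainTheorem9 {A : Type*} [Ring A] [StarRing A] [Algebra ℂ A] [StarModule ℂ A]
    (φ : A →ₗ[ℂ] ℂ) (hφ : BiFree.IsStarState φ) (u_l u_r : unitary A)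
    (hu : BiFree.IsBiHaarUnitaryPair φ u_l u_r) :
    (∀ n : ℕ, 1 ≤ n → ∀ (χ : Fin (2 * n) → BiFree.Side) (a : Fin (2 * n) → A),
      BiFree.Compatible (u_l : A) (u_r : A) χ a →
      BiFree.IsStarAlternating (u_l : A) (u_r : A) (fun k => a (BiFree.sPerm χ k)) →
      BiFree.cumulant φ χ a = (-1) ^ (n - 1) * (catalan (n - 1) : ℂ)) ∧
    (∀ n : ℕ, 1 ≤ n → ∀ (χ : Fin n → BiFree.Side) (a : Fin n → A),
      (∀ i, a i = u_l ∨ a i = star (u_l : A) ∨ a i = u_r ∨ a i = star (u_r : A)) →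
      ¬ (Even n ∧
        BiFree.IsStarAlternating (u_l : A) (u_r : A) (fun k => a (BiFree.sPerm χ k))) →
      BiFree.cumulant φ χ a = 0) ∧
    BiFree.IsBiRDiagonal φ (u_l : A) (u_r : A) := by
  have hzero : ∀ n : ℕ, 1 ≤ n → ∀ (χ : Fin n → BiFree.Side) (a : Fin n → A),
      (∀ i, a i = u_l ∨ a i = star (u_l : A) ∨ a i = u_r ∨ a i = star (u_r : A)) →
      ¬ (Even n ∧
        BiFree.IsStarAlternating (u_l : A) (u_r : A) (fun k => a (BiFree.sPerm χ k))) →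
      BiFree.cumulant φ χ a = 0 := by
    intro n hn χ a ha h
    obtain ⟨ε, hε, hκ, halt⟩ := hu.exists_cumulant_eq hn χ a ha
    rw [halt] at h
    rw [hκ, BiFree.haarWeight_univ_eq_zero hε hn h]
  refine ⟨fun n hn χ a ha h => ?_, hzero, fun n hn χ a ha => ⟨fun hodd => ?_, fun heven h => ?_⟩⟩
  · obtain ⟨ε, hε, hκ, halt⟩ := hu.exists_cumulant_eq (by omega) χ a ha.entry
    rw [hκ, BiFree.haarWeight_univ_of_consecutive hn hε (halt.1 h)]
  · exact hzero n hn χ a ha.entry fun h => (Nat.not_even_iff_odd.2 hodd) h.1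
  · refine hzero n hn χ a ha.entry fun hcon => h ?_
    exact BiFree.isAllowedWord_of_isStarAlternating (fun x y hx hy => hu.ne_star hx hy) heven ha
      hcon.2
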